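/- Let $m\ge 1$ be an integer and let $C\subset\mathbb C$ be a simple closed curve of class $C^{m}$ with length $L$ and a counter-clockwise unit-speed parametrization $z(s)$, $s\in[0,L]$ (extended $L$-periodically to a $C^m$ function on $\mathbb R$). Let $C=\partial\Omega$, where $\Omega\subset\mathbb C$ is a bounded domain of area $F$, let $\boldsymbol n$ be the outward-pointing unit normal on $C$, and, when $m\ge 2$, let $\boldsymbol\kappa=\frac{d^2z}{ds^2}$ be the curvature vector. Assume that $C$ has centroid $0$, i.e. $\int_C z\,ds=0$. Let the integers $s_{m,1},\dots,s_{m,m-1}$ be defined by $$\sum_{l=1}^{m-1}s_{m,l}\,t^{l-1}=\frac{P_m(t)-P_m(1)}{t-1},\qquad P_m(t)=\prod_{j=2}^{m}(t-j^2).$$ Then $$ 0\le \sum_{l=1}^{m-1}s_{m,l}\left(\frac{L}{2\pi}\right)^{2l-3}\int_C\left|\left(\frac{d}{ds}\right)^{l-1}\left(z+\left(\frac{L}{2\pi}\right)^2\boldsymbol\kappa\right)\right|^2ds -\frac{(-1)^m}{2}(m-1)!\,(m+1)!\left(\frac1\pi\left(L^2-4\pi F\right)-\frac{2\pi}{L}\int_C\left|z-\frac{L}{2\pi}\boldsymbol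 n\right|^2ds\right), $$ where the sum is empty for $m=1$. Equality holds if and only if there is $b\in\mathbb C$ such that, with $t=\frac{2\pi}{L}s$, the curve is given by $z=b\,e^{it}$, i.e. $z(s)=b\,e^{2\pi i s/L}$ for all $s$. -/

import Mathlib

open Complex MeasureTheory Set Filter Topology

noncomputable section

/-- A simple closed curve of class `C^m` in the plane with its unit-speed parametrization: an
`L`-periodic function `z` of class `C^m`, injective on one period, with `|z'| = 1`. In particular
`L` is the length of the curve. -/
structure IsSimpleClosedUnitSpeedCurve (m : ℕ) (L : ℝ) (z : ℝ → ℂ) : Prop where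
  length_pos : 0 < L
  contDiff : ContDiff ℝ m z
  periodic : Function.Periodic z L
  injOn : InjOn z (Ico 0 L)
  unit_speed : ∀ s, ‖deriv z s‖ = 1

/-- `Ω` is a bounded domain whose boundary is the trace of `z`. -/
structure IsEnclosedDomain (z : ℝ → ℂ) (Ω : Set ℂ) : Prop where
  isOpen : IsOpen Ω
  isConnected : IsConnected Ω
  isBounded : Bornology.IsBounded Ω
  frontier_eq : frontier Ω = range z

/-- The boundary curve `z` of `Ω` is traversed counter-clockwise: `Ω` lies to the left of the
direction of travel. -/
def IsCounterclockwise (z : ℝ → ℂ) (Ω : Set ℂ) : Prop :=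
  ∀ s, ∀ᶠ ε : ℝ in 𝓝[>] 0, z s + (ε : ℂ) * (I * deriv z s) ∈ Ω

/-- `n` is the unit normal field along `z` that points out of `Ω`. -/
structure IsOutwardUnitNormal (z : ℝ → ℂ) (Ω : Set ℂ) (n : ℝ → ℂ) : Prop where
  norm_eq_one : ∀ s, ‖n s‖ = 1
  orthogonal : ∀ s, inner ℝ (n s) (deriv z s) = 0
  outward : ∀ s, ∀ᶠ ε : ℝ in 𝓝[>] 0, z s + (ε : ℂ) * n s ∉ closure Ω

/-- The centroid of the curve, with respect to arc length. -/
def curveCentroid (L : ℝ) (z : ℝ → ℂ) : ℂ := (L : ℂ)⁻¹ * ∫ s in (0 : ℝ)..L, z s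

/-- The curvature vector of a unit-speed curve. -/
def curvatureVector (z : ℝ → ℂ) : ℝ → ℂ := deriv (deriv z)

/-- `P_m(t) = (t - 2²)(t - 3²) ⋯ (t - m²)`. -/
def polyP (m : ℕ) : Polynomial ℤ :=
  ∏ j ∈ Finset.Icc 2 m, (Polynomial.X - Polynomial.C ((j : ℤ) ^ 2))

/-- `S_m(t) = (P_m(t) - P_m(1)) / (t - 1)`, an exact division. -/
def polyS (m : ℕ) : Polynomial ℤ :=
  (polyP m - Polynomial.C ((polyP m).eval 1)) /ₘ (Polynomial.X - Polynomial.C 1)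

/-- The integers `s_{m,l}` in `S_m(t) = ∑_{l=1}^{m-1} s_{m,l} t^{l-1}`, used for `1 ≤ l`. -/
def sCoeff (m l : ℕ) : ℤ := (polyS m).coeff (l - 1)

/-- The quantity of order `m` attached to a curve `z` of length `L`, with normal field `n` and
enclosed area `F`. -/
def higherIsoperimetricForm (m : ℕ) (L : ℝ) (z n : ℝ → ℂ) (F : ℝ) : ℝ :=
  (∑ l ∈ Finset.Icc 1 (m - 1),
      (sCoeff m l : ℝ) * (L / (2 * Real.pi)) ^ (2 * (l : ℤ) - 3) *
        ∫ s in (0 : ℝ)..L,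
          ‖iteratedDeriv (l - 1)
            (fun u => z u + ((L / (2 * Real.pi) : ℝ) : ℂ) ^ 2 * curvatureVector z u) s‖ ^ 2)
    - (-1) ^ m / 2 * ((m - 1).factorial : ℝ) * ((m + 1).factorial : ℝ) *
        (1 / Real.pi * (L ^ 2 - 4 * Real.pi * F)
          - 2 * Real.pi / L *
            ∫ s in (0 : ℝ)..L, ‖z s - ((L / (2 * Real.pi) : ℝ) : ℂ) * n s‖ ^ 2)

end

/-!
The form is a weighted sum of squares of Fourier coefficients. Put `R = L / 2π` and
`z(s) = ∑ a_k exp(i k s / R)`. Since `|z'| = 1`, Parseval's identity gives `R² = ∑ k² |a_k|²`, and it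
turns the `l`-th integral into a multiple of `∑ k^(2(l-1)) (k² - 1)² |a_k|²`. The outward normal is
`n = -i z'`, so the cross term of `∫ |z - R n|²` is a multiple of `Im ∫ z̄ dz`, which by Green's
formula is twice the enclosed area; hence the area cancels from the form. The definition of the
`s_{m,l}` and the value of `P_m(1)` then combine everything into
`(L / R) ∑ (k² - 1) P_m(k²) |a_k|²` (`hasSum_higherIsoperimetricForm`). The weights
`(k² - 1)(k² - 2²) ⋯ (k² - m²)` vanish for `1 ≤ |k| ≤ m` and are positive for `|k| > m`, and `a_0 = 0`
because the centroid is the origin. This gives the inequality.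

In the case of equality `z'` is a trigonometric polynomial with `|z'| = 1`. A polynomial of modulus
one on the unit circle is a monomial (`Polynomial.eq_C_mul_X_pow_of_norm_eval_eq_one`), so
`z = b exp(i p s / R)`. Injectivity on a period leaves `p = ± 1`, and `p = -1` is impossible since it
makes the area negative.

Green's formula for a `C¹` curve (`IsSimpleClosedUnitSpeedCurve.area_eq`) is obtained from winding
numbers, without the Jordan curve theorem. The winding number is locally constant off the curve,
and it jumps by one across the curve (`IsSimpleClosedUnitSpeedCurve.tendsto_cauchyIntegral_sub`).
So does the indicator function of `Ω`; the difference of the two is therefore locally constant on the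
whole plane, and it vanishes far away, so the winding number equals the indicator function off
the curve. Integrating the winding number over a large disc, exchanging the integrals and
inserting the Cauchy transform `π ζ̄` of the disc (`integral_ball_inv_sub`) gives
`2i |Ω| = ∫ z̄ dz`.
-/

/-! ### The Cauchy integral of a curve and its jump -/

/-- The Cauchy integral `∫_a^b z'(s) / (z(s) - p) ds` of the arc `z|[a, b]` at the point `p`. Over
a full period it is `2πi` times the winding number of the curve around `p`. -/
noncomputable def cauchyIntegral (z : ℝ → ℂ) (a b : ℝ) (p : ℂ) : ℂ :=
  ∫ s in a..b, deriv z s / (z s - p)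

lemma continuousOn_cauchyKernel {z : ℝ → ℂ} (hz : ContDiff ℝ 1 z) {S : Set ℝ} {p : ℂ}
    (hp : p ∉ z '' S) : ContinuousOn (fun s => deriv z s / (z s - p)) S := by
  refine (hz.continuous_deriv le_rfl).continuousOn.div
    (hz.continuous.sub continuous_const).continuousOn fun s hs h => hp ⟨s, hs, sub_eq_zero.1 h⟩

lemma intervalIntegrable_cauchyKernel {z : ℝ → ℂ} (hz : ContDiff ℝ 1 z) {a b : ℝ} {p : ℂ}
    (hp : p ∉ z '' uIcc a b) :
    IntervalIntegrable (fun s => deriv z s / (z s - p)) volume a b :=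
  (continuousOn_cauchyKernel hz hp).intervalIntegrable

lemma continuousAt_cauchyIntegral {z : ℝ → ℂ} (hz : ContDiff ℝ 1 z) {a b : ℝ} {p : ℂ}
    (hp : p ∉ z '' uIcc a b) : ContinuousAt (cauchyIntegral z a b) p := by
  have hcomp : IsCompact (z '' uIcc a b) := isCompact_uIcc.image hz.continuous
  obtain ⟨r, hr, hball⟩ := Metric.isOpen_iff.1 hcomp.isClosed.isOpen_compl p hp
  have hfar : ∀ q ∈ Metric.ball p (r / 2), ∀ s ∈ uIcc a b, r / 2 ≤ ‖z s - q‖ := by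
    intro q hq s hs
    by_contra! hlt
    refine hball ?_ (mem_image_of_mem z hs)
    rw [Metric.mem_ball, dist_eq_norm] at hq ⊢
    have : z s - p = (z s - q) + (q - p) := by ring
    rw [this]
    linarith [norm_add_le (z s - q) (q - p)]
  have hcont := hz.continuous_deriv le_rfl
  refine intervalIntegral.continuousAt_of_dominated_interval
    (bound := fun s => ‖deriv z s‖ / (r / 2)) ?_ ?_ ?_ ?_
  · filter_upwards [Metric.ball_mem_nhds p (half_pos hr)] with q hq
    refine ((continuousOn_cauchyKernel hz ?_).mono uIoc_subset_uIcc).aestronglyMeasurable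
      measurableSet_uIoc
    rintro ⟨s, hs, rfl⟩
    simpa using (half_pos hr).trans_le (hfar _ hq s hs)
  · filter_upwards [Metric.ball_mem_nhds p (half_pos hr)] with q hq
    refine ae_of_all _ fun s hs => ?_
    rw [norm_div]
    exact div_le_div_of_nonneg_left (norm_nonneg _) (half_pos hr)
      (hfar q hq s (uIoc_subset_uIcc hs))
  · exact (hcont.norm.div_const _).intervalIntegrable _ _
  · refine ae_of_all _ fun s hs => ?_
    refine continuousAt_const.div (continuousAt_const.sub continuousAt_id) fun h => hp ?_
    exact ⟨s, uIoc_subset_uIcc hs, sub_eq_zero.1 h⟩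

lemma cauchyIntegral_eq_log_sub_log {z : ℝ → ℂ} (hz : ContDiff ℝ 1 z) {a b : ℝ} {p c : ℂ}
    (h : ∀ s ∈ uIcc a b, c * (z s - p) ∈ slitPlane) :
    cauchyIntegral z a b p = Complex.log (c * (z b - p)) - Complex.log (c * (z a - p)) := by
  have hp : p ∉ z '' uIcc a b := by
    rintro ⟨s, hs, rfl⟩
    simpa using h s hs
  refine intervalIntegral.integral_eq_sub_of_hasDerivAt
    (f := fun s => Complex.log (c * (z s - p))) (fun s hs => ?_)
    (intervalIntegrable_cauchyKernel hz hp)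
  have hd : HasDerivAt (fun s => c * (z s - p)) (c * deriv z s) s :=
    ((hz.differentiable one_ne_zero s).hasDerivAt.sub_const p).const_mul c
  have := hd.clog_real (h s hs)
  have hne := slitPlane_ne_zero (h s hs)
  refine this.congr_deriv ?_
  have h1 := left_ne_zero_of_mul hne
  have h2 := right_ne_zero_of_mul hne
  field_simp

/-- Winding numbers are integers: `exp (-∫_0^s z' / (z - p)) (z(s) - p)` is constant in `s`. -/
lemma exists_int_cauchyIntegral_eq {z : ℝ → ℂ} {L : ℝ} (hz : ContDiff ℝ 1 z)
    (hper : Function.Periodic z L) {p : ℂ} (hp : p ∉ range z) :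
    ∃ k : ℤ, cauchyIntegral z 0 L p = k * (2 * Real.pi * I) := by
  have hne : ∀ s, z s - p ≠ 0 := fun s h => hp ⟨s, sub_eq_zero.1 h⟩
  have hcont : Continuous fun s => deriv z s / (z s - p) :=
    (hz.continuous_deriv le_rfl).div (hz.continuous.sub continuous_const) hne
  have hd : ∀ s, HasDerivAt (fun s => Complex.exp (-cauchyIntegral z 0 s p) * (z s - p)) 0 s := by
    intro s
    have h1 : HasDerivAt (fun s => cauchyIntegral z 0 s p) (deriv z s / (z s - p)) s :=
      intervalIntegral.integral_hasDerivAt_right (hcont.intervalIntegrable _ _)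
        (hcont.stronglyMeasurableAtFilter _ _) hcont.continuousAt
    have h2 : HasDerivAt (fun s => z s - p) (deriv z s) s :=
      (hz.differentiable one_ne_zero s).hasDerivAt.sub_const p
    refine (h1.neg.cexp.mul h2).congr_deriv ?_
    have := hne s
    field_simp
    ring
  have hconst := is_const_of_deriv_eq_zero (fun s => (hd s).differentiableAt)
    (fun s => (hd s).deriv) L 0
  have hzL : z L = z 0 := by simpa using hper 0
  have h0 : cauchyIntegral z 0 0 p = 0 := intervalIntegral.integral_same
  simp only [h0, hzL, neg_zero, Complex.exp_zero] at hconst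
  have := mul_right_cancel₀ (hne 0) hconst
  obtain ⟨k, hk⟩ := Complex.exp_eq_one_iff.1 this
  exact ⟨-k, by push_cast; rw [neg_mul, ← hk, neg_neg]⟩

lemma Function.Periodic.deriv' {f : ℝ → ℂ} {L : ℝ} (hf : Function.Periodic f L) :
    Function.Periodic (deriv f) L := by
  intro s
  rw [← deriv_comp_add_const]
  exact congrArg (fun f => deriv f s) (funext hf)

lemma cauchyIntegral_period {z : ℝ → ℂ} {L : ℝ} (hper : Function.Periodic z L) (a : ℝ) (p : ℂ) :
    cauchyIntegral z a (a + L) p = cauchyIntegral z 0 L p := by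
  have hd : Function.Periodic (deriv z) L := hper.deriv'
  have h : Function.Periodic (fun s => deriv z s / (z s - p)) L := by
    intro s
    simp only [hd s, hper s]
  simpa [cauchyIntegral] using h.intervalIntegral_add_eq a 0

lemma log_sub_log_neg_of_im_pos {a : ℂ} (ha : 0 < a.im) :
    Complex.log a - Complex.log (-a) = Real.pi * I := by
  have h : Complex.arg (-a) = Complex.arg a - Real.pi := Complex.arg_neg_eq_arg_sub_pi_of_im_pos ha
  simp only [Complex.log, norm_neg, h]
  push_cast
  ring

/-- Parameters `s₀`, `δ` for which the arc over `[s₀ - δ, s₀ + δ]` advances along the tangent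
at `s₀`, while the rest of the curve stays away from `z s₀`. -/
structure IsTangentArc (L : ℝ) (z : ℝ → ℂ) (s₀ δ : ℝ) : Prop where
  pos : 0 < δ
  two_mul_lt : 2 * δ < L
  strictMonoOn : StrictMonoOn (fun s => ((starRingEnd ℂ) (deriv z s₀) * z s).re)
    (Icc (s₀ - δ) (s₀ + δ))
  notMem_rest : z s₀ ∉ z '' Icc (s₀ + δ) (s₀ - δ + L)

/-- Injectivity on a period, in a form that does not depend on where the period starts. -/
lemma IsSimpleClosedUnitSpeedCurve.exists_int {m : ℕ} {L : ℝ} {z : ℝ → ℂ}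
    (hz : IsSimpleClosedUnitSpeedCurve m L z) {s t : ℝ} (h : z s = z t) :
    ∃ k : ℤ, s - t = k * L := by
  have hL := hz.length_pos
  have key : ∀ x, z (toIcoMod hL 0 x) = z x := fun x => by
    rw [toIcoMod, hz.periodic.sub_zsmul_eq]
  have hmem : ∀ x, toIcoMod hL 0 x ∈ Ico 0 L := fun x => by
    simpa using toIcoMod_mem_Ico hL 0 x
  have := hz.injOn (hmem s) (hmem t) (by rw [key, key, h])
  refine ⟨toIcoDiv hL 0 s - toIcoDiv hL 0 t, ?_⟩
  simp only [toIcoMod, zsmul_eq_mul] at this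
  push_cast
  linarith

lemma IsSimpleClosedUnitSpeedCurve.exists_isTangentArc {m : ℕ} {L : ℝ} {z : ℝ → ℂ}
    (hm : 1 ≤ m) (hz : IsSimpleClosedUnitSpeedCurve m L z) (s₀ : ℝ) :
    ∃ δ, IsTangentArc L z s₀ δ := by
  have hL := hz.length_pos
  have hz1 : ContDiff ℝ 1 z := hz.contDiff.of_le (by exact_mod_cast hm)
  set τ := deriv z s₀ with hτ
  have hcont : Continuous fun s => ((starRingEnd ℂ) τ * deriv z s).re :=
    Complex.continuous_re.comp (continuous_const.mul (hz1.continuous_deriv le_rfl))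
  have hpos : 0 < ((starRingEnd ℂ) τ * deriv z s₀).re := by
    rw [← hτ, ← Complex.normSq_eq_conj_mul_self, Complex.ofReal_re, Complex.normSq_eq_norm_sq,
      hz.unit_speed]
    norm_num
  obtain ⟨r, hr, hball⟩ := Metric.isOpen_iff.1 (isOpen_Ioi.preimage hcont) s₀ hpos
  refine ⟨min (r / 2) (L / 4), by positivity, ?_, ?_, ?_⟩
  · linarith [min_le_right (r / 2) (L / 4)]
  · have hd : ∀ s, HasDerivAt (fun s => ((starRingEnd ℂ) τ * z s).re)
        ((starRingEnd ℂ) τ * deriv z s).re s := fun s =>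
      Complex.reCLM.hasFDerivAt.comp_hasDerivAt s
        ((hz1.differentiable one_ne_zero s).hasDerivAt.const_mul ((starRingEnd ℂ) τ))
    refine strictMonoOn_of_deriv_pos (convex_Icc _ _)
      (fun s _ => (hd s).continuousAt.continuousWithinAt) fun s hs => ?_
    rw [(hd s).deriv]
    rw [interior_Icc] at hs
    refine hball ?_
    rw [Metric.mem_ball, Real.dist_eq, abs_lt]
    have := min_le_left (r / 2) (L / 4)
    constructor <;> linarith [hs.1, hs.2]
  · rintro ⟨s, hs, h⟩
    have hδ : 0 < min (r / 2) (L / 4) := by positivity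
    obtain ⟨k, hk⟩ := hz.exists_int h
    have h1 : 0 < (k : ℝ) * L := by linarith [hs.1]
    have h2 : (k : ℝ) * L < 1 * L := by linarith [hs.2]
    have h3 : 0 < (k : ℝ) := pos_of_mul_pos_left h1 hL.le
    have h4 : (k : ℝ) < 1 := lt_of_mul_lt_mul_right h2 hL.le
    norm_cast at h3 h4
    omega

/-- The jump of the Cauchy integral across the curve is `2πi`. On a short arc around `s₀` the
integrand has, at a point `p` on either side on the normal line, the primitive
`log (± i τ̄ (z - p))` with `τ` the tangent vector; the rest of the curve contributes continuously. -/
lemma IsSimpleClosedUnitSpeedCurve.tendsto_cauchyIntegral_sub {m : ℕ} {L : ℝ} {z : ℝ → ℂ}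
    (hm : 1 ≤ m) (hz : IsSimpleClosedUnitSpeedCurve m L z) (s₀ : ℝ) :
    Tendsto (fun ε : ℝ => cauchyIntegral z 0 L (z s₀ + (ε : ℂ) * (I * deriv z s₀))
      - cauchyIntegral z 0 L (z s₀ - (ε : ℂ) * (I * deriv z s₀))) (𝓝[>] 0)
      (𝓝 (2 * Real.pi * I)) := by
  have hL := hz.length_pos
  have hz1 : ContDiff ℝ 1 z := hz.contDiff.of_le (by exact_mod_cast hm)
  obtain ⟨δ, hδ⟩ := hz.exists_isTangentArc hm s₀
  set τ := deriv z s₀ with hτ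
  set A : ℝ → ℂ := fun s => I * (starRingEnd ℂ) τ * (z s - z s₀) with hA
  have hττ : (starRingEnd ℂ) τ * τ = 1 := by
    rw [← Complex.normSq_eq_conj_mul_self, Complex.normSq_eq_norm_sq, hτ, hz.unit_speed]
    norm_num
  have hAim : ∀ s, (A s).im =
      ((starRingEnd ℂ) τ * z s).re - ((starRingEnd ℂ) τ * z s₀).re := by
    intro s
    rw [← Complex.sub_re, ← Complex.I_mul_im, ← mul_sub, ← mul_assoc]
  have hδp := hδ.pos
  have hmem0 : s₀ ∈ Icc (s₀ - δ) (s₀ + δ) := ⟨by linarith, by linarith⟩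
  have hmemp : s₀ + δ ∈ Icc (s₀ - δ) (s₀ + δ) := ⟨by linarith, by linarith⟩
  have hmemm : s₀ - δ ∈ Icc (s₀ - δ) (s₀ + δ) := ⟨by linarith, by linarith⟩
  have hAne : ∀ s ∈ Icc (s₀ - δ) (s₀ + δ), s ≠ s₀ → (A s).im ≠ 0 := by
    intro s hs hne h
    rw [hAim, sub_eq_zero] at h
    exact hne (hδ.strictMonoOn.injOn hs hmem0 h)
  have hAp : 0 < (A (s₀ + δ)).im := by
    rw [hAim, sub_pos]
    exact hδ.strictMonoOn hmem0 hmemp (by linarith)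
  have hAm : (A (s₀ - δ)).im < 0 := by
    rw [hAim, sub_neg]
    exact hδ.strictMonoOn hmemm hmem0 (by linarith)
  have hA0 : A s₀ = 0 := by simp [hA]
  have hslit : ∀ s ∈ Icc (s₀ - δ) (s₀ + δ), ∀ ε : ℝ, 0 < ε →
      A s + ε ∈ slitPlane ∧ -A s + ε ∈ slitPlane := by
    intro s hs ε hε
    by_cases h : s = s₀
    · subst h
      simp [hA0, slitPlane, hε]
    · have := hAne s hs h
      simp [slitPlane, this]
  have huIcc : uIcc (s₀ - δ) (s₀ + δ) = Icc (s₀ - δ) (s₀ + δ) := uIcc_of_le (by linarith)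
  have harc : ∀ ε : ℝ, 0 < ε →
      cauchyIntegral z (s₀ - δ) (s₀ + δ) (z s₀ + (ε : ℂ) * (I * τ))
        - cauchyIntegral z (s₀ - δ) (s₀ + δ) (z s₀ - (ε : ℂ) * (I * τ))
      = (Complex.log (A (s₀ + δ) + ε) - Complex.log (A (s₀ - δ) + ε))
        - (Complex.log (-A (s₀ + δ) + ε) - Complex.log (-A (s₀ - δ) + ε)) := by
    intro ε hε
    have e1 : ∀ s, I * (starRingEnd ℂ) τ * (z s - (z s₀ + (ε : ℂ) * (I * τ))) = A s + ε := by
      intro s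
      linear_combination (-(ε : ℂ) * I ^ 2) * hττ - (ε : ℂ) * Complex.I_sq
    have e2 : ∀ s, -(I * (starRingEnd ℂ) τ) * (z s - (z s₀ - (ε : ℂ) * (I * τ))) = -A s + ε := by
      intro s
      linear_combination (-(ε : ℂ) * I ^ 2) * hττ - (ε : ℂ) * Complex.I_sq
    rw [cauchyIntegral_eq_log_sub_log hz1 (c := I * (starRingEnd ℂ) τ),
      cauchyIntegral_eq_log_sub_log hz1 (c := -(I * (starRingEnd ℂ) τ))]
    · simp only [e1, e2]
    · intro s hs
      rw [e2]
      exact (hslit s (huIcc ▸ hs) ε hε).2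
    · intro s hs
      rw [e1]
      exact (hslit s (huIcc ▸ hs) ε hε).1
  have hin1 : Tendsto (fun ε : ℝ => z s₀ + (ε : ℂ) * (I * τ)) (𝓝[>] 0) (𝓝 (z s₀)) := by
    have : Continuous fun ε : ℝ => z s₀ + (ε : ℂ) * (I * τ) := by fun_prop
    simpa using (this.tendsto 0).mono_left nhdsWithin_le_nhds
  have hin2 : Tendsto (fun ε : ℝ => z s₀ - (ε : ℂ) * (I * τ)) (𝓝[>] 0) (𝓝 (z s₀)) := by
    have : Continuous fun ε : ℝ => z s₀ - (ε : ℂ) * (I * τ) := by fun_prop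
    simpa using (this.tendsto 0).mono_left nhdsWithin_le_nhds
  have hrestne : z s₀ ∉ z '' uIcc (s₀ + δ) (s₀ - δ + L) := by
    rw [uIcc_of_le (by linarith [hδ.two_mul_lt])]
    exact hδ.notMem_rest
  have hrest : Tendsto (fun ε : ℝ =>
      cauchyIntegral z (s₀ + δ) (s₀ - δ + L) (z s₀ + (ε : ℂ) * (I * τ))
        - cauchyIntegral z (s₀ + δ) (s₀ - δ + L) (z s₀ - (ε : ℂ) * (I * τ))) (𝓝[>] 0)
      (𝓝 0) := by
    have hc := continuousAt_cauchyIntegral hz1 hrestne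
    simpa using (hc.tendsto.comp hin1).sub (hc.tendsto.comp hin2)
  have hlog : ∀ a : ℂ, a.im ≠ 0 →
      Tendsto (fun ε : ℝ => Complex.log (a + ε)) (𝓝[>] 0) (𝓝 (Complex.log a)) := by
    intro a ha
    have h1 : Tendsto (fun ε : ℝ => a + (ε : ℂ)) (𝓝[>] 0) (𝓝 a) := by
      have : Continuous fun ε : ℝ => a + (ε : ℂ) := by fun_prop
      simpa using (this.tendsto 0).mono_left nhdsWithin_le_nhds
    exact h1.clog (by simp [slitPlane, ha])
  have harclim : Tendsto (fun ε : ℝ =>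
      (Complex.log (A (s₀ + δ) + ε) - Complex.log (A (s₀ - δ) + ε))
        - (Complex.log (-A (s₀ + δ) + ε) - Complex.log (-A (s₀ - δ) + ε))) (𝓝[>] 0)
      (𝓝 (2 * Real.pi * I)) := by
    have := ((hlog _ hAp.ne').sub (hlog _ hAm.ne)).sub
      ((hlog (-A (s₀ + δ)) (by simpa using hAp.ne')).sub
        (hlog (-A (s₀ - δ)) (by simpa using hAm.ne)))
    convert this using 2
    have e1 := log_sub_log_neg_of_im_pos hAp
    have e2 := log_sub_log_neg_of_im_pos (a := -A (s₀ - δ)) (by simpa using hAm)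
    rw [neg_neg] at e2
    linear_combination -e1 - e2
  have hsum := harclim.add hrest
  rw [add_zero] at hsum
  refine hsum.congr' ?_
  -- Points of the normal line close to `z s₀` are off the rest of the curve.
  have hoff : ∀ᶠ q in 𝓝 (z s₀), q ∉ z '' uIcc (s₀ + δ) (s₀ - δ + L) :=
    ((isCompact_uIcc.image hz1.continuous).isClosed.isOpen_compl).mem_nhds hrestne
  filter_upwards [self_mem_nhdsWithin, hin1.eventually hoff, hin2.eventually hoff] with ε hε h1 h2
  have split : ∀ q, q ∉ z '' uIcc (s₀ + δ) (s₀ - δ + L) →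
      q ∉ z '' uIcc (s₀ - δ) (s₀ + δ) →
      cauchyIntegral z 0 L q =
        cauchyIntegral z (s₀ - δ) (s₀ + δ) q + cauchyIntegral z (s₀ + δ) (s₀ - δ + L) q := by
    intro q hq1 hq2
    rw [← cauchyIntegral_period hz.periodic (s₀ - δ) q]
    exact (intervalIntegral.integral_add_adjacent_intervals
      (intervalIntegrable_cauchyKernel hz1 hq2) (intervalIntegrable_cauchyKernel hz1 hq1)).symm
  have hε' : (0 : ℝ) < ε := hε
  rw [split _ h1, split _ h2, ← harc ε hε']
  · ring
  · rintro ⟨s, hs, hsq⟩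
    have := (hslit s (huIcc ▸ hs) ε hε').2
    apply slitPlane_ne_zero this
    simp only [hA, hsq]
    linear_combination ((ε : ℂ) * I ^ 2) * hττ + (ε : ℂ) * Complex.I_sq
  · rintro ⟨s, hs, hsq⟩
    have := (hslit s (huIcc ▸ hs) ε hε').1
    apply slitPlane_ne_zero this
    simp only [hA, hsq]
    linear_combination ((ε : ℂ) * I ^ 2) * hττ + (ε : ℂ) * Complex.I_sq

/-! ### The winding number is the indicator function of the domain -/

/-- The curve has area zero, being the image of the real axis under a map of the plane whose
derivative is singular. -/
lemma volume_range_eq_zero {z : ℝ → ℂ} (hz : Differentiable ℝ z) : volume (range z) = 0 := by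
  have hd : ∀ w : ℂ, HasFDerivAt (fun w : ℂ => z w.re)
      ((ContinuousLinearMap.toSpanSingleton ℝ (deriv z w.re)).comp Complex.reCLM) w := fun w =>
    HasFDerivAt.comp w (hz w.re).hasDerivAt.hasFDerivAt Complex.reCLM.hasFDerivAt
  have h := addHaar_image_eq_zero_of_det_fderivWithin_eq_zero volume (s := univ)
    (fun w _ => (hd w).hasFDerivWithinAt) fun w _ => by
      refine LinearMap.det_eq_zero_iff_ker_ne_bot.2 fun hbot => ?_
      have hI : (I : ℂ) ∈ LinearMap.ker ((((ContinuousLinearMap.toSpanSingleton ℝ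
          (deriv z w.re)).comp Complex.reCLM : ℂ →L[ℝ] ℂ)) : ℂ →ₗ[ℝ] ℂ) := by
        simp
      rw [hbot] at hI
      simp at hI
  refine measure_mono_null ?_ h
  rintro _ ⟨s, rfl⟩
  exact ⟨s, mem_univ _, by simp⟩

lemma dense_compl_range {z : ℝ → ℂ} (hz : Differentiable ℝ z) : Dense (range z)ᶜ :=
  Measure.dense_of_ae (μ := volume) (p := fun p => p ∉ range z)
    (measure_eq_zero_iff_ae_notMem.1 (volume_range_eq_zero hz))

lemma Function.Periodic.isCompact_range {z : ℝ → ℂ} {L : ℝ} (hper : Function.Periodic z L)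
    (hL : 0 < L) (hz : Continuous z) : IsCompact (range z) := by
  rw [← hper.image_Icc hL 0]
  exact isCompact_Icc.image hz

lemma cauchyIntegral_eq_of_isPreconnected {z : ℝ → ℂ} {L : ℝ} (hz : ContDiff ℝ 1 z)
    (hper : Function.Periodic z L) {S : Set ℂ} (hS : IsPreconnected S)
    (hdisj : ∀ q ∈ S, q ∉ range z) {p q : ℂ} (hp : p ∈ S) (hq : q ∈ S) :
    cauchyIntegral z 0 L p = cauchyIntegral z 0 L q := by
  have hpi : (2 * Real.pi * I : ℂ) ≠ 0 := Complex.two_pi_I_ne_zero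
  set g : ℂ → ℝ := fun q => (cauchyIntegral z 0 L q / (2 * Real.pi * I)).re with hg
  have hgint : ∀ q ∈ S, ∃ k : ℤ, g q = k ∧ cauchyIntegral z 0 L q = k * (2 * Real.pi * I) := by
    intro q hq
    obtain ⟨k, hk⟩ := exists_int_cauchyIntegral_eq hz hper (hdisj q hq)
    refine ⟨k, ?_, hk⟩
    simp only [hg, hk, mul_div_cancel_right₀ _ hpi, Complex.intCast_re]
  have hcont : ContinuousOn g S := by
    intro q hq
    have : ContinuousAt (cauchyIntegral z 0 L) q := continuousAt_cauchyIntegral hz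
      fun h => hdisj q hq (image_subset_range _ _ h)
    exact (Complex.continuous_re.continuousAt.comp (this.div_const _)).continuousWithinAt
  have hdisc : IsDiscrete (range ((↑) : ℤ → ℝ)) := by
    have : DiscreteTopology (range ((↑) : ℤ → ℝ)) :=
      Int.isClosedEmbedding_coe_real.isEmbedding.toHomeomorph.symm.isEmbedding.discreteTopology
    exact ⟨this⟩
  have heq := hS.constant_of_mapsTo hdisc hcont
    (fun q hq => by obtain ⟨k, hk, -⟩ := hgint q hq; exact ⟨k, hk.symm⟩) hp hq
  obtain ⟨k, hk, hk'⟩ := hgint p hp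
  obtain ⟨l, hl, hl'⟩ := hgint q hq
  have hkl : k = l := by rw [hk, hl] at heq; exact_mod_cast heq
  rw [hk', hl', hkl]

/-- Collar of the curve at `z s₀`: the map `(s, t) ↦ z s + t i z'(s₀)` covers a
neighbourhood of `z s₀`, and it hits the curve only for `t = 0`. -/
lemma IsSimpleClosedUnitSpeedCurve.exists_collar {m : ℕ} {L : ℝ} {z : ℝ → ℂ}
    (hm : 1 ≤ m) (hz : IsSimpleClosedUnitSpeedCurve m L z) (s₀ : ℝ) :
    ∃ δ : ℝ, 0 < δ ∧ ∃ r : ℝ, 0 < r ∧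
      (∀ s ∈ Ioo (s₀ - δ) (s₀ + δ), ∀ t ∈ Ioo (-r) r,
        z s + (t : ℂ) * (I * deriv z s₀) ∈ range z → t = 0) ∧
      (fun x : ℝ × ℝ => z x.1 + (x.2 : ℂ) * (I * deriv z s₀)) ''
        (Ioo (s₀ - δ) (s₀ + δ) ×ˢ Ioo (-r) r) ∈ 𝓝 (z s₀) := by
  have hL := hz.length_pos
  have hz1 : ContDiff ℝ 1 z := hz.contDiff.of_le (by exact_mod_cast hm)
  obtain ⟨δ₀, hδ₀⟩ := hz.exists_isTangentArc hm s₀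
  have hδ₀p := hδ₀.pos
  set τ := deriv z s₀ with hτ
  have hττ : (starRingEnd ℂ) τ * τ = 1 := by
    rw [← Complex.normSq_eq_conj_mul_self, Complex.normSq_eq_norm_sq, hτ, hz.unit_speed]
    norm_num
  have hclosed : IsClosed (z '' Icc (s₀ + δ₀) (s₀ - δ₀ + L)) :=
    (isCompact_Icc.image hz1.continuous).isClosed
  obtain ⟨d, hd, hball⟩ := Metric.isOpen_iff.1 hclosed.isOpen_compl _ hδ₀.notMem_rest
  obtain ⟨η, hη, hηball⟩ := Metric.continuousAt_iff.1 (hz1.continuous.continuousAt (x := s₀))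
    (d / 2) (half_pos hd)
  refine ⟨min δ₀ η, by positivity, d / 2, half_pos hd, ?_, ?_⟩
  · rintro s hs t ht ⟨s', hs'⟩
    have hs1 : s ∈ Icc (s₀ - δ₀) (s₀ + δ₀) :=
      ⟨by linarith [hs.1, min_le_left δ₀ η], by linarith [hs.2, min_le_left δ₀ η]⟩
    have hs2 : dist s s₀ < η := by
      rw [Real.dist_eq, abs_lt]
      constructor <;> linarith [hs.1, hs.2, min_le_right δ₀ η]
    -- The representative of `s'` in the period that starts at the beginning of the arc.
    set u := toIcoMod hL (s₀ - δ₀) s' with hu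
    have huI : u ∈ Ico (s₀ - δ₀) (s₀ - δ₀ + L) := toIcoMod_mem_Ico hL _ s'
    have hzu : z u = z s + (t : ℂ) * (I * τ) := by
      rw [← hs', hu, toIcoMod, hz.periodic.sub_zsmul_eq]
    have hmem : z u ∈ Metric.ball (z s₀) d := by
      rw [hzu, Metric.mem_ball, dist_eq_norm]
      have h1 : ‖z s - z s₀‖ < d / 2 := by rw [← dist_eq_norm]; exact hηball hs2
      have h2 : ‖(t : ℂ) * (I * τ)‖ < d / 2 := by
        rw [norm_mul, norm_mul, Complex.norm_I, hτ, hz.unit_speed, Complex.norm_real,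
          Real.norm_eq_abs, mul_one, mul_one, abs_lt]
        exact ht
      calc ‖z s + (t : ℂ) * (I * τ) - z s₀‖ = ‖(z s - z s₀) + (t : ℂ) * (I * τ)‖ := by ring_nf
        _ ≤ _ := norm_add_le _ _
        _ < d := by linarith
    have hu2 : u ∈ Icc (s₀ - δ₀) (s₀ + δ₀) := by
      refine ⟨huI.1, ?_⟩
      by_contra! hlt
      exact hball hmem ⟨u, ⟨hlt.le, huI.2.le⟩, rfl⟩
    have hre : ((starRingEnd ℂ) τ * z u).re = ((starRingEnd ℂ) τ * z s).re := by
      have : (starRingEnd ℂ) τ * z u = (starRingEnd ℂ) τ * z s + t * I := by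
        rw [hzu]
        linear_combination ((t : ℂ) * I) * hττ
      rw [this]
      simp
    have hus : u = s := hδ₀.strictMonoOn.injOn hu2 hs1 hre
    rw [hus] at hzu
    have hne : I * τ ≠ 0 := mul_ne_zero I_ne_zero (right_ne_zero_of_mul_eq_one hττ)
    simpa [hne] using hzu
  · set Φ : ℝ × ℝ → ℂ := fun x => z x.1 + (x.2 : ℂ) * (I * τ) with hΦ
    have hΦ0 : Φ (s₀, 0) = z s₀ := by simp [hΦ]
    have hsm : ContDiff ℝ 1 Φ :=
      (hz1.comp contDiff_fst).add
        ((Complex.ofRealCLM.contDiff.comp contDiff_snd).mul contDiff_const)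
    set Φ' : ℝ × ℝ →L[ℝ] ℂ :=
      (ContinuousLinearMap.toSpanSingleton ℝ τ).comp (ContinuousLinearMap.fst ℝ ℝ ℝ) +
      (ContinuousLinearMap.toSpanSingleton ℝ (I * τ)).comp (ContinuousLinearMap.snd ℝ ℝ ℝ)
      with hΦ'
    have hfd : HasFDerivAt Φ Φ' (s₀, 0) := by
      have h1 : HasFDerivAt (fun x : ℝ × ℝ => z x.1) ((ContinuousLinearMap.toSpanSingleton ℝ
          τ).comp (ContinuousLinearMap.fst ℝ ℝ ℝ)) (s₀, 0) :=
        HasFDerivAt.comp (s₀, 0) (hz1.differentiable one_ne_zero s₀).hasDerivAt.hasFDerivAt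
          hasFDerivAt_fst
      have h2 := ((ContinuousLinearMap.toSpanSingleton ℝ (I * τ)).comp
        (ContinuousLinearMap.snd ℝ ℝ ℝ)).hasFDerivAt (x := (s₀, (0 : ℝ)))
      refine (h1.add h2).congr_of_eventuallyEq (Eventually.of_forall fun x => ?_)
      simp [hΦ]
    have hstrict : HasStrictFDerivAt Φ Φ' (s₀, 0) :=
      hsm.contDiffAt.hasStrictFDerivAt' hfd one_ne_zero
    have hsurj : LinearMap.range (Φ' : ℝ × ℝ →ₗ[ℝ] ℂ) = ⊤ := by
      rw [LinearMap.range_eq_top]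
      intro w
      refine ⟨(((starRingEnd ℂ) τ * w).re, ((starRingEnd ℂ) τ * w).im), ?_⟩
      have := Complex.re_add_im ((starRingEnd ℂ) τ * w)
      simp only [hΦ', ContinuousLinearMap.coe_coe, _root_.add_apply,
        ContinuousLinearMap.comp_apply, ContinuousLinearMap.coe_fst', ContinuousLinearMap.coe_snd',
        ContinuousLinearMap.toSpanSingleton_apply, Complex.real_smul]
      linear_combination τ * this + w * hττ
    have hmap := hstrict.map_nhds_eq_of_surj hsurj
    rw [hΦ0] at hmap
    rw [← hmap]
    refine image_mem_map (prod_mem_nhds (Ioo_mem_nhds ?_ ?_) (Ioo_mem_nhds ?_ ?_))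
    · linarith [show 0 < min δ₀ η by positivity]
    · linarith [show 0 < min δ₀ η by positivity]
    · linarith
    · linarith

lemma indicator_const_of_isPreconnected {Ω S : Set ℂ} (hS : IsPreconnected S)
    (hdisj : ∀ q ∈ S, q ∉ frontier Ω) {p q : ℂ} (hp : p ∈ S) (hq : q ∈ S) (c : ℂ) :
    Ω.indicator (fun _ => c) p = Ω.indicator (fun _ => c) q := by
  have key : ∀ p ∈ S, ∀ q ∈ S, p ∈ Ω → q ∈ Ω := by
    intro p hp q hq hpΩ
    by_contra hqΩ
    have hin : ∀ x ∈ S, x ∈ Ω → x ∈ interior Ω := fun x hx hxΩ => by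
      by_contra h
      exact hdisj x hx ⟨subset_closure hxΩ, h⟩
    have hout : ∀ x ∈ S, x ∉ Ω → x ∈ (closure Ω)ᶜ := fun x hx hxΩ h =>
      hdisj x hx ⟨h, fun h' => hxΩ (interior_subset h')⟩
    obtain ⟨x, -, hx1, hx2⟩ := hS (interior Ω) (closure Ω)ᶜ isOpen_interior
      isClosed_closure.isOpen_compl
      (fun x hx => (em (x ∈ Ω)).imp (hin x hx) (hout x hx))
      ⟨p, hp, hin p hp hpΩ⟩ ⟨q, hq, hout q hq hqΩ⟩
    exact hx2 (interior_subset_closure hx1)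
  by_cases h : p ∈ Ω
  · rw [indicator_of_mem h, indicator_of_mem (key p hp q hq h)]
  · rw [indicator_of_notMem h, indicator_of_notMem fun h' => h (key q hq p hp h')]

/-- The Cauchy integral and `2πi` times the indicator function of the domain have the same jump
across the curve, so that their difference is constant near each point of the plane. -/
lemma IsSimpleClosedUnitSpeedCurve.exists_nhds_cauchyIntegral_sub_indicator {m : ℕ} {L : ℝ}
    {z : ℝ → ℂ} {Ω : Set ℂ} (hm : 1 ≤ m) (hz : IsSimpleClosedUnitSpeedCurve m L z)
    (hfr : frontier Ω = range z) (hleft : IsCounterclockwise z Ω)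
    (hright : ∀ s, ∀ᶠ ε : ℝ in 𝓝[>] 0, z s - (ε : ℂ) * (I * deriv z s) ∉ Ω) (p : ℂ) :
    ∃ c : ℂ, ∀ᶠ q in 𝓝 p, q ∉ range z →
      cauchyIntegral z 0 L q - Ω.indicator (fun _ => 2 * Real.pi * I) q = c := by
  have hz1 : ContDiff ℝ 1 z := hz.contDiff.of_le (by exact_mod_cast hm)
  have hconst : ∀ S : Set ℂ, IsPreconnected S → (∀ q ∈ S, q ∉ range z) → ∀ p ∈ S, ∀ q ∈ S,
      cauchyIntegral z 0 L p - Ω.indicator (fun _ => 2 * Real.pi * I) p =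
        cauchyIntegral z 0 L q - Ω.indicator (fun _ => 2 * Real.pi * I) q := by
    intro S hS hd p hp q hq
    rw [cauchyIntegral_eq_of_isPreconnected hz1 hz.periodic hS hd hp hq,
      indicator_const_of_isPreconnected hS (by rwa [hfr]) hp hq]
  by_cases hp : p ∈ range z
  · obtain ⟨s₀, rfl⟩ := hp
    obtain ⟨δ, hδ, r, hr, hoff, hnhds⟩ := hz.exists_collar hm s₀
    set Φ : ℝ × ℝ → ℂ := fun x => z x.1 + (x.2 : ℂ) * (I * deriv z s₀) with hΦ
    have hΦc : Continuous Φ := by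
      have := hz1.continuous
      fun_prop
    have hpre : ∀ T : Set ℝ, IsPreconnected T →
        IsPreconnected (Φ '' (Ioo (s₀ - δ) (s₀ + δ) ×ˢ T)) := fun T hT =>
      (isPreconnected_Ioo.prod hT).image _ hΦc.continuousOn
    have hs₀ : s₀ ∈ Ioo (s₀ - δ) (s₀ + δ) := ⟨by linarith, by linarith⟩
    set f : ℂ → ℂ := fun q =>
      cauchyIntegral z 0 L q - Ω.indicator (fun _ => 2 * Real.pi * I) q with hf
    have hup : ∀ x ∈ Ioo (s₀ - δ) (s₀ + δ) ×ˢ Ioo 0 r, ∀ y ∈ Ioo (s₀ - δ) (s₀ + δ) ×ˢ Ioo 0 r,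
        f (Φ x) = f (Φ y) := by
      intro x hx y hy
      refine hconst _ (hpre _ isPreconnected_Ioo) ?_ _ (mem_image_of_mem Φ hx) _
        (mem_image_of_mem Φ hy)
      rintro _ ⟨⟨s, t⟩, ⟨hs, ht⟩, rfl⟩ hmem
      exact ht.1.ne' (hoff s hs t ⟨by linarith [ht.1], ht.2⟩ hmem)
    have hlo : ∀ x ∈ Ioo (s₀ - δ) (s₀ + δ) ×ˢ Ioo (-r) 0,
        ∀ y ∈ Ioo (s₀ - δ) (s₀ + δ) ×ˢ Ioo (-r) 0, f (Φ x) = f (Φ y) := by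
      intro x hx y hy
      refine hconst _ (hpre _ isPreconnected_Ioo) ?_ _ (mem_image_of_mem Φ hx) _
        (mem_image_of_mem Φ hy)
      rintro _ ⟨⟨s, t⟩, ⟨hs, ht⟩, rfl⟩ hmem
      exact ht.2.ne (hoff s hs t ⟨ht.1, by linarith [ht.2]⟩ hmem)
    have hmid : f (Φ (s₀, r / 2)) = f (Φ (s₀, -(r / 2))) := by
      have hlim := hz.tendsto_cauchyIntegral_sub hm s₀
      have hev : ∀ᶠ ε : ℝ in 𝓝[>] 0, f (Φ (s₀, r / 2)) - f (Φ (s₀, -(r / 2))) =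
          (cauchyIntegral z 0 L (z s₀ + (ε : ℂ) * (I * deriv z s₀))
            - cauchyIntegral z 0 L (z s₀ - (ε : ℂ) * (I * deriv z s₀))) - 2 * Real.pi * I := by
        filter_upwards [hleft s₀, hright s₀, Ioo_mem_nhdsGT hr] with ε h1 h2 h3
        rw [hup (s₀, r / 2) ⟨hs₀, by constructor <;> simp only <;> linarith⟩ (s₀, ε) ⟨hs₀, h3⟩,
          hlo (s₀, -(r / 2)) ⟨hs₀, by constructor <;> simp only <;> linarith⟩ (s₀, -ε)
            ⟨hs₀, by constructor <;> simp only <;> linarith [h3.1, h3.2]⟩]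
        have e : Φ (s₀, -ε) = z s₀ - (ε : ℂ) * (I * deriv z s₀) := by
          simp only [hΦ]
          push_cast
          ring
        rw [e]
        simp only [hf, hΦ, indicator_of_mem h1, indicator_of_notMem h2]
        ring
      have h0 := hlim.sub_const (2 * Real.pi * I : ℂ)
      rw [sub_self] at h0
      exact sub_eq_zero.1 (tendsto_nhds_unique (tendsto_const_nhds.congr' hev) h0)
    refine ⟨f (Φ (s₀, r / 2)), ?_⟩
    filter_upwards [hnhds] with q hq hqr
    obtain ⟨⟨s, t⟩, ⟨hs, ht⟩, rfl⟩ := hq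
    rcases lt_trichotomy t 0 with h | h | h
    · rw [hmid]
      exact hlo _ ⟨hs, ht.1, h⟩ _ ⟨hs₀, by constructor <;> simp only <;> linarith⟩
    · exact absurd ⟨s, by simp [hΦ, h]⟩ hqr
    · exact hup _ ⟨hs, h, ht.2⟩ _ ⟨hs₀, by constructor <;> simp only <;> linarith⟩
  · have hopen : IsOpen (range z)ᶜ :=
      (hz.periodic.isCompact_range hz.length_pos hz1.continuous).isClosed.isOpen_compl
    obtain ⟨ρ, hρ, hball⟩ := Metric.isOpen_iff.1 hopen p hp
    refine ⟨cauchyIntegral z 0 L p - Ω.indicator (fun _ => 2 * Real.pi * I) p, ?_⟩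
    filter_upwards [Metric.ball_mem_nhds p hρ] with q hq _
    exact hconst _ (convex_ball p ρ).isPreconnected (fun q hq => hball hq) q hq p
      (Metric.mem_ball_self hρ)

lemma norm_cauchyIntegral_le {z : ℝ → ℂ} {L M d : ℝ} (hL : 0 ≤ L) (hd : 0 < d)
    (hspeed : ∀ s, ‖deriv z s‖ = 1) (hM : ∀ s, ‖z s‖ ≤ M) {p : ℂ} (hp : M + d ≤ ‖p‖) :
    ‖cauchyIntegral z 0 L p‖ ≤ d⁻¹ * L := by
  have := intervalIntegral.norm_integral_le_of_norm_le_const (a := 0) (b := L) (C := d⁻¹)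
    (f := fun s => deriv z s / (z s - p)) fun s _ => by
      rw [norm_div, hspeed, one_div]
      refine inv_anti₀ hd ?_
      have := norm_sub_norm_le p (z s)
      rw [norm_sub_rev] at this
      linarith [hM s]
  simpa [cauchyIntegral, abs_of_nonneg hL] using this

/-- Off the curve, the winding number is the indicator function of the domain. -/
theorem IsSimpleClosedUnitSpeedCurve.cauchyIntegral_eq_indicator {m : ℕ} {L : ℝ}
    {z : ℝ → ℂ} {Ω : Set ℂ} (hm : 1 ≤ m) (hz : IsSimpleClosedUnitSpeedCurve m L z)
    (hfr : frontier Ω = range z) (hbdd : Bornology.IsBounded Ω) (hleft : IsCounterclockwise z Ω)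
    (hright : ∀ s, ∀ᶠ ε : ℝ in 𝓝[>] 0, z s - (ε : ℂ) * (I * deriv z s) ∉ Ω) {p : ℂ}
    (hp : p ∉ range z) :
    cauchyIntegral z 0 L p = Ω.indicator (fun _ => 2 * Real.pi * I) p := by
  have hL := hz.length_pos
  have hz1 : ContDiff ℝ 1 z := hz.contDiff.of_le (by exact_mod_cast hm)
  choose F hF using hz.exists_nhds_cauchyIntegral_sub_indicator hm hfr hleft hright
  have hdense := dense_compl_range (hz1.differentiable one_ne_zero)
  have hloc : IsLocallyConstant F := by
    rw [IsLocallyConstant.iff_eventually_eq]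
    intro x
    filter_upwards [(hF x).eventually_nhds] with y hy
    obtain ⟨q, hq, hqr⟩ := hdense.inter_nhds_nonempty (hy.and (hF y))
    exact (hqr.2 hq).symm.trans (hqr.1 hq)
  have hcomp := hz.periodic.isCompact_range hL hz1.continuous
  obtain ⟨M, hM⟩ := (hcomp.isBounded.union hbdd).exists_norm_le
  have hM0 : 0 ≤ M := (norm_nonneg _).trans (hM (z 0) (Or.inl ⟨0, rfl⟩))
  -- A point so far away that the winding number around it has absolute value less than one.
  set x : ℂ := ((M + L : ℝ) : ℂ) with hx
  have hxn : ‖x‖ = M + L := by rw [hx, Complex.norm_real, Real.norm_of_nonneg (by linarith)]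
  have hxr : x ∉ range z := fun h => by linarith [hM x (Or.inl h)]
  have hxΩ : x ∉ Ω := fun h => by linarith [hM x (Or.inr h)]
  have hx0 : cauchyIntegral z 0 L x = 0 := by
    obtain ⟨k, hk⟩ := exists_int_cauchyIntegral_eq hz1 hz.periodic hxr
    have hle := norm_cauchyIntegral_le hL.le hL hz.unit_speed (fun s => hM _ (Or.inl ⟨s, rfl⟩))
      hxn.ge
    rw [inv_mul_cancel₀ hL.ne', hk, norm_mul, Complex.norm_intCast] at hle
    have h2 : ‖(2 * Real.pi * I : ℂ)‖ = 2 * Real.pi := by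
      simp [abs_of_pos Real.pi_pos]
    rw [h2] at hle
    have : |(k : ℝ)| < 1 := by
      by_contra! h
      nlinarith [Real.pi_gt_three]
    have hk0 : k = 0 := Int.abs_lt_one_iff.1 (by exact_mod_cast this)
    rw [hk, hk0]
    simp
  have hFx : F x = 0 := by
    rw [← (hF x).self_of_nhds hxr, hx0, indicator_of_notMem hxΩ, sub_zero]
  have hFp := (hF p).self_of_nhds hp
  rw [hloc.apply_eq_of_isPreconnected isPreconnected_univ (mem_univ p) (mem_univ x), hFx] at hFp
  exact sub_eq_zero.1 hFp

/-! ### The Cauchy transform of a disc and Green's formula for the area -/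

lemma integrableOn_ball_norm_inv (M : ℝ) :
    IntegrableOn (fun q : ℂ => ‖q‖⁻¹) (Metric.ball 0 M) := by
  refine integrableOn_ball_of_norm_le_rpow (α := 1) (C := 1) (by simp) (by simp)
    (ae_of_all _ fun x => ?_) (by fun_prop)
  simp [Real.rpow_neg_one]

lemma circleAverage_inv_sub_of_lt {ζ : ℂ} {r : ℝ} (hr : 0 ≤ r) (h : r < ‖ζ‖) :
    Real.circleAverage (fun p => (ζ - p)⁻¹) 0 r = ζ⁻¹ := by
  have hne : ∀ p ∈ Metric.closedBall (0 : ℂ) r, ζ - p ≠ 0 := by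
    intro p hp h0
    rw [mem_closedBall_zero_iff, ← sub_eq_zero.1 h0] at hp
    linarith
  have hd : DifferentiableOn ℂ (fun p => (ζ - p)⁻¹) (Metric.closedBall 0 r) := by
    intro p hp
    exact ((differentiableAt_id.const_sub ζ).inv (hne p hp)).differentiableWithinAt
  have : DiffContOnCl ℂ (fun p => (ζ - p)⁻¹) (Metric.ball 0 |r|) := by
    rw [abs_of_nonneg hr]
    exact hd.diffContOnCl_ball subset_rfl
  simpa using this.circleAverage

lemma circleAverage_inv_sub_of_gt {ζ : ℂ} {r : ℝ} (hζ : ζ ≠ 0) (h : ‖ζ‖ < r) :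
    Real.circleAverage (fun p => (ζ - p)⁻¹) 0 r = 0 := by
  have hr : 0 < r := (norm_nonneg ζ).trans_lt h
  have hne : ∀ p ∈ Metric.sphere (0 : ℂ) |r|, ζ - p ≠ 0 := by
    intro p hp h0
    rw [mem_sphere_zero_iff_norm, ← sub_eq_zero.1 h0, abs_of_pos hr] at hp
    linarith
  have h1 : Real.circleAverage (fun p => ((p - 0) / (p - ζ)) • (1 : ℂ)) 0 r = 1 :=
    (diffContOnCl_const (c := (1 : ℂ))).circleAverage_smul_div (by
      rwa [mem_ball_zero_iff, abs_of_pos hr])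
  have hint : CircleIntegrable (fun p => -ζ • (ζ - p)⁻¹) 0 r := by
    refine ContinuousOn.circleIntegrable' ?_
    exact ((continuousOn_const.sub continuousOn_id).inv₀ hne).const_smul (-ζ)
  have h2 : Real.circleAverage (fun p => ((p - 0) / (p - ζ)) • (1 : ℂ)) 0 r =
      Real.circleAverage ((fun _ => (1 : ℂ)) + fun p => -ζ • (ζ - p)⁻¹) 0 r := by
    refine Real.circleAverage_congr_sphere fun p hp => ?_
    have := hne p hp
    have h' : p - ζ ≠ 0 := fun h0 => this (by linear_combination -h0)
    simp only [Pi.add_apply, smul_eq_mul]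
    field_simp
    ring
  rw [h2, Real.circleAverage_add (circleIntegrable_const _ _ _) hint,
    Real.circleAverage_const, Real.circleAverage_fun_smul] at h1
  simpa [hζ] using h1

lemma integral_Ioo_circleMap (f : ℂ → ℂ) (r : ℝ) :
    ∫ θ in Ioo (-Real.pi) Real.pi, f (circleMap 0 r θ) =
      2 * Real.pi * Real.circleAverage f 0 r := by
  have hper : Function.Periodic (fun θ => f (circleMap 0 r θ)) (2 * Real.pi) := fun θ => by
    simp only [periodic_circleMap 0 r θ]
  have h := hper.intervalIntegral_add_eq (-Real.pi) 0
  rw [show -Real.pi + 2 * Real.pi = Real.pi by ring, zero_add] at h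
  rw [← integral_Ioc_eq_integral_Ioo, ← intervalIntegral.integral_of_le (by linarith [Real.pi_pos]),
    h, Real.circleAverage_def, Complex.real_smul]
  push_cast
  field_simp

/-- Integration in polar coordinates over a disc, as an integral of circle averages. -/
lemma integral_ball_eq_integral_circleAverage {f : ℂ → ℂ} {M : ℝ} (hf : Measurable f)
    (hint : IntegrableOn f (Metric.ball 0 M)) :
    ∫ p in Metric.ball 0 M, f p =
      ∫ r in Ioo 0 M, (2 * Real.pi * r : ℂ) * Real.circleAverage f 0 r := by
  set g : ℂ → ℂ := (Metric.ball 0 M).indicator f with hg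
  have hgm : Measurable g := hf.indicator measurableSet_ball
  have hgint : Integrable g := hint.integrable_indicator measurableSet_ball
  have hcont : Continuous fun p : ℝ × ℝ => Complex.polarCoord.symm p := by
    simp only [Complex.polarCoord_symm_apply]
    fun_prop
  have hGint : IntegrableOn (fun p : ℝ × ℝ => p.1 • g (Complex.polarCoord.symm p))
      (Ioi 0 ×ˢ Ioo (-Real.pi) Real.pi) (volume.prod volume) := by
    refine ⟨(measurable_fst.smul (hgm.comp hcont.measurable)).aestronglyMeasurable, ?_⟩
    have h := Complex.lintegral_comp_polarCoord_symm fun p => ‖g p‖ₑ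
    have h' : ∫⁻ p in Ioi 0 ×ˢ Ioo (-Real.pi) Real.pi,
        ‖p.1 • g (Complex.polarCoord.symm p)‖ₑ ∂(volume.prod volume) = ∫⁻ p, ‖g p‖ₑ := by
      rw [← h]
      refine setLIntegral_congr_fun (measurableSet_Ioi.prod measurableSet_Ioo) fun p hp => ?_
      rw [enorm_smul, smul_eq_mul, Real.enorm_eq_ofReal (le_of_lt hp.1)]
    rw [HasFiniteIntegral, h']
    exact hgint.2
  have hpol := Complex.integral_comp_polarCoord_symm g
  rw [integral_indicator measurableSet_ball] at hpol
  rw [← hpol]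
  have : (polarCoord.target : Set (ℝ × ℝ)) = Ioi 0 ×ˢ Ioo (-Real.pi) Real.pi := rfl
  rw [this, Measure.volume_eq_prod, setIntegral_prod _ hGint]
  have hinner : ∀ r ∈ Ioi (0 : ℝ),
      ∫ θ in Ioo (-Real.pi) Real.pi, r • g (Complex.polarCoord.symm (r, θ)) =
        (Iio M).indicator (fun r : ℝ => (2 * Real.pi * r : ℂ) * Real.circleAverage f 0 r) r := by
    intro r hr
    have hsymm : ∀ θ, Complex.polarCoord.symm (r, θ) = circleMap 0 r θ := fun θ => by
      rw [Complex.polarCoord_symm_apply, circleMap_zero, Complex.exp_mul_I]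
      simp
    have hmem : ∀ θ, circleMap 0 r θ ∈ Metric.ball (0 : ℂ) M ↔ r < M := fun θ => by
      rw [mem_ball_zero_iff, norm_circleMap_zero, abs_of_pos hr]
    by_cases h : r < M
    · simp only [hsymm, hg, indicator_of_mem ((hmem _).2 h), indicator_of_mem (mem_Iio.2 h)]
      rw [integral_smul, integral_Ioo_circleMap, Complex.real_smul]
      ring
    · simp only [hsymm, hg, indicator_of_notMem (mt (hmem _).1 h), indicator_of_notMem
        (mt mem_Iio.1 h), smul_zero, integral_zero]
  rw [setIntegral_congr_fun measurableSet_Ioi hinner, setIntegral_indicator measurableSet_Iio,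
    Ioi_inter_Iio]

lemma integrableOn_ball_inv_sub {ζ : ℂ} {M : ℝ} (hζ : ‖ζ‖ < M) :
    IntegrableOn (fun p => (ζ - p)⁻¹) (Metric.ball 0 M) ∧
      ∫ p in Metric.ball 0 M, ‖(ζ - p)⁻¹‖ ≤ ∫ q in Metric.ball (0 : ℂ) (2 * M), ‖q‖⁻¹ := by
  set g : ℂ → ℝ := (Metric.ball 0 (2 * M)).indicator fun q => ‖q‖⁻¹ with hg
  have hgint : Integrable g :=
    (integrableOn_ball_norm_inv (2 * M)).integrable_indicator measurableSet_ball
  have hg0 : ∀ q, 0 ≤ g q := fun q => indicator_nonneg (fun _ _ => by positivity) q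
  have hle : ∀ p ∈ Metric.ball (0 : ℂ) M, ‖(ζ - p)⁻¹‖ = g (ζ - p) := by
    intro p hp
    rw [hg, indicator_of_mem, norm_inv]
    rw [mem_ball_zero_iff] at hp ⊢
    linarith [norm_sub_le ζ p]
  have hgs : Integrable fun p => g (ζ - p) := hgint.comp_sub_left ζ
  refine ⟨?_, ?_⟩
  · refine Integrable.mono' hgs.integrableOn (by fun_prop) ?_
    filter_upwards [ae_restrict_mem measurableSet_ball] with p hp using (hle p hp).le
  · rw [setIntegral_congr_fun measurableSet_ball hle]
    refine (setIntegral_le_integral hgs (ae_of_all _ fun p => hg0 _)).trans ?_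
    rw [integral_sub_left_eq_self, integral_indicator measurableSet_ball]

/-- The Cauchy transform of a disc centred at the origin is `π ζ̄` inside the disc. -/
lemma integral_ball_inv_sub {ζ : ℂ} {M : ℝ} (hζ : ‖ζ‖ < M) :
    ∫ p in Metric.ball 0 M, (ζ - p)⁻¹ = Real.pi * (starRingEnd ℂ) ζ := by
  have hint := (integrableOn_ball_inv_sub hζ).1
  rcases eq_or_ne ζ 0 with rfl | h0
  · -- At the centre the integrand is odd.
    have h := integral_neg_eq_self ((Metric.ball (0 : ℂ) M).indicator fun p => (0 - p)⁻¹) volume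
    have hodd : ∀ p, (Metric.ball (0 : ℂ) M).indicator (fun p => (0 - p)⁻¹) (-p) =
        -(Metric.ball (0 : ℂ) M).indicator (fun p => (0 - p)⁻¹) p := by
      intro p
      by_cases hp : p ∈ Metric.ball (0 : ℂ) M
      · have hp' : -p ∈ Metric.ball (0 : ℂ) M := by simpa using hp
        rw [indicator_of_mem hp, indicator_of_mem hp', ← inv_neg]
        ring_nf
      · have hp' : -p ∉ Metric.ball (0 : ℂ) M := by simpa using hp
        rw [indicator_of_notMem hp, indicator_of_notMem hp', neg_zero]
    simp only [hodd, integral_neg] at h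
    rw [integral_indicator measurableSet_ball] at h
    rw [map_zero, mul_zero]
    exact self_eq_neg.1 h.symm
  have hζ0 : 0 < ‖ζ‖ := norm_pos_iff.2 h0
  rw [integral_ball_eq_integral_circleAverage (by fun_prop) hint]
  have hae : ∀ᵐ r : ℝ ∂volume.restrict (Ioo 0 M),
      (2 * Real.pi * r : ℂ) * Real.circleAverage (fun p => (ζ - p)⁻¹) 0 r =
        (Iio ‖ζ‖).indicator (fun r : ℝ => (2 * Real.pi * r : ℂ) * ζ⁻¹) r := by
    filter_upwards [ae_restrict_mem measurableSet_Ioo,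
      ae_restrict_of_ae (Measure.ae_ne volume ‖ζ‖)] with r hr hne
    rcases lt_or_gt_of_ne hne with h | h
    · rw [circleAverage_inv_sub_of_lt hr.1.le h, indicator_of_mem (mem_Iio.2 h)]
    · rw [circleAverage_inv_sub_of_gt h0 h, indicator_of_notMem (notMem_Iio.2 h.le),
        mul_zero]
  rw [integral_congr_ae hae, setIntegral_indicator measurableSet_Iio, Ioo_inter_Iio,
    min_eq_right hζ.le, ← integral_Ioc_eq_integral_Ioo,
    ← intervalIntegral.integral_of_le hζ0.le]
  have : ∀ r : ℝ, (2 * Real.pi * r : ℂ) * ζ⁻¹ = (r : ℂ) * (2 * Real.pi * ζ⁻¹) := fun r => by ring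
  simp only [this]
  rw [intervalIntegral.integral_mul_const, intervalIntegral.integral_ofReal, integral_id]
  have hsq : (starRingEnd ℂ) ζ * ζ = ((‖ζ‖ ^ 2 : ℝ) : ℂ) := by
    rw [← Complex.normSq_eq_conj_mul_self, Complex.normSq_eq_norm_sq]
  field_simp
  rw [mul_comm ζ, hsq]
  push_cast
  ring

/-- **Green's formula for the area**, `2i |Ω| = ∮ z̄ dz`: integrate the winding number, which is
the indicator function of the domain, over a large disc, and use the Cauchy transform of the disc. -/
theorem IsSimpleClosedUnitSpeedCurve.area_eq {m : ℕ} {L : ℝ}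
    {z : ℝ → ℂ} {Ω : Set ℂ} (hm : 1 ≤ m) (hz : IsSimpleClosedUnitSpeedCurve m L z)
    (hΩ : IsEnclosedDomain z Ω) (hleft : IsCounterclockwise z Ω)
    (hright : ∀ s, ∀ᶠ ε : ℝ in 𝓝[>] 0, z s - (ε : ℂ) * (I * deriv z s) ∉ Ω) :
    2 * I * volume.real Ω = ∫ s in (0 : ℝ)..L, (starRingEnd ℂ) (z s) * deriv z s := by
  have hL := hz.length_pos
  have hz1 : ContDiff ℝ 1 z := hz.contDiff.of_le (by exact_mod_cast hm)
  have hcomp := hz.periodic.isCompact_range hL hz1.continuous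
  obtain ⟨M₀, hM₀⟩ := (hcomp.isBounded.union hΩ.isBounded).exists_norm_le
  set M := M₀ + 1 with hMdef
  have hzM : ∀ s, ‖z s‖ < M := fun s => by linarith [hM₀ _ (Or.inl ⟨s, rfl⟩)]
  have hΩM : Ω ⊆ Metric.ball 0 M := fun p hp => by
    rw [mem_ball_zero_iff]
    linarith [hM₀ _ (Or.inr hp)]
  have hwind : ∫ p in Metric.ball 0 M, cauchyIntegral z 0 L p =
      volume.real Ω * (2 * Real.pi * I) := by
    have hae : ∀ᵐ p ∂volume.restrict (Metric.ball (0 : ℂ) M),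
        cauchyIntegral z 0 L p = Ω.indicator (fun _ => 2 * Real.pi * I) p := by
      filter_upwards [ae_restrict_of_ae (measure_eq_zero_iff_ae_notMem.1
        (volume_range_eq_zero (hz1.differentiable one_ne_zero)))] with p hp
      exact hz.cauchyIntegral_eq_indicator hm hΩ.frontier_eq hΩ.isBounded hleft hright hp
    rw [integral_congr_ae hae, setIntegral_indicator hΩ.isOpen.measurableSet,
      inter_eq_right.2 hΩM, setIntegral_const, Complex.real_smul]
  have hcd := hz1.continuous_deriv le_rfl
  have hFub : Integrable (Function.uncurry fun (s : ℝ) (p : ℂ) => deriv z s / (z s - p))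
      ((volume.restrict (Ioc 0 L)).prod (volume.restrict (Metric.ball 0 M))) := by
    have hmeas : Measurable
        (Function.uncurry fun (s : ℝ) (p : ℂ) => deriv z s / (z s - p)) := by
      have h1 := hz1.continuous.measurable
      have h2 := hcd.measurable
      exact (h2.comp measurable_fst).div ((h1.comp measurable_fst).sub measurable_snd)
    rw [integrable_prod_iff hmeas.aestronglyMeasurable]
    refine ⟨ae_of_all _ fun s => ?_, ?_⟩
    · simp only [Function.uncurry_apply_pair, div_eq_mul_inv]
      exact (integrableOn_ball_inv_sub (hzM s)).1.const_mul _
    · refine Integrable.mono' (integrable_const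
        (∫ q in Metric.ball (0 : ℂ) (2 * M), ‖q‖⁻¹))
        hmeas.aestronglyMeasurable.norm.integral_prod_right' (ae_of_all _ fun s => ?_)
      simp only [Function.uncurry_apply_pair, div_eq_mul_inv, norm_mul, hz.unit_speed, one_mul]
      rw [Real.norm_of_nonneg (integral_nonneg fun p => norm_nonneg _)]
      exact (integrableOn_ball_inv_sub (hzM s)).2
  have hswap : ∫ p in Metric.ball 0 M, cauchyIntegral z 0 L p =
      ∫ s in (0 : ℝ)..L, deriv z s * (Real.pi * (starRingEnd ℂ) (z s)) := by
    simp only [cauchyIntegral, intervalIntegral.integral_of_le hL.le]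
    rw [← integral_integral_swap hFub]
    refine integral_congr_ae (ae_of_all _ fun s => ?_)
    simp only [div_eq_mul_inv]
    rw [integral_const_mul, integral_ball_inv_sub (hzM s)]
  rw [hwind] at hswap
  have hpull : ∫ s in (0 : ℝ)..L, deriv z s * (Real.pi * (starRingEnd ℂ) (z s)) =
      Real.pi * ∫ s in (0 : ℝ)..L, (starRingEnd ℂ) (z s) * deriv z s := by
    rw [← intervalIntegral.integral_const_mul]
    exact intervalIntegral.integral_congr fun s _ => by ring
  rw [hpull] at hswap
  have hpi : (Real.pi : ℂ) ≠ 0 := by exact_mod_cast Real.pi_ne_zero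
  apply mul_left_cancel₀ hpi
  rw [← hswap]
  ring

/-! ### Fourier coefficients of periodic functions -/

lemma fourierCoeffOn_deriv {f : ℝ → ℂ} {L : ℝ} (hL : 0 < L) (hf : ContDiff ℝ 1 f)
    (hper : Function.Periodic f L) (k : ℤ) :
    fourierCoeffOn hL (deriv f) k = (2 * Real.pi * I * k / L) * fourierCoeffOn hL f k := by
  have hd : ∀ x ∈ uIcc 0 L, HasDerivAt f (deriv f x) x := fun x _ =>
    (hf.differentiable one_ne_zero x).hasDerivAt
  have hint : IntervalIntegrable (deriv f) volume 0 L :=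
    (hf.continuous_deriv le_rfl).intervalIntegrable _ _
  have hfL : f L = f 0 := by simpa using hper 0
  rcases eq_or_ne k 0 with rfl | hk
  · rw [fourierCoeffOn_eq_integral]
    simp only [neg_zero, fourier_zero, one_smul, Int.cast_zero, mul_zero, zero_div, zero_mul]
    rw [intervalIntegral.integral_eq_sub_of_hasDerivAt hd hint, hfL, sub_self, smul_zero]
  · have hLc : (L : ℂ) ≠ 0 := by exact_mod_cast hL.ne'
    have hkc : (k : ℂ) ≠ 0 := by exact_mod_cast hk
    have hpi : (Real.pi : ℂ) ≠ 0 := by exact_mod_cast Real.pi_ne_zero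
    rw [fourierCoeffOn_of_hasDerivAt hL hk hd hint, hfL]
    have hI := I_ne_zero
    field_simp
    simp

lemma fourierCoeffOn_iteratedDeriv {L : ℝ} (hL : 0 < L) (j : ℕ) {f : ℝ → ℂ}
    (hf : ContDiff ℝ j f) (hper : Function.Periodic f L) (k : ℤ) :
    fourierCoeffOn hL (iteratedDeriv j f) k =
      (2 * Real.pi * I * k / L) ^ j * fourierCoeffOn hL f k := by
  induction j generalizing f with
  | zero => simp [iteratedDeriv_zero]
  | succ j ih =>
    have hf' : ContDiff ℝ ((j : WithTop ℕ∞) + 1) f := by exact_mod_cast hf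
    rw [iteratedDeriv_succ', ih (contDiff_succ_iff_deriv.1 hf').2.2 hper.deriv',
      fourierCoeffOn_deriv hL (hf'.of_le (by simp)) hper]
    ring

lemma hasSum_sq_fourierCoeffOn_of_continuous {L : ℝ} (hL : 0 < L) {f : ℝ → ℂ}
    (hf : Continuous f) :
    HasSum (fun k => ‖fourierCoeffOn hL f k‖ ^ 2) (L⁻¹ * ∫ s in (0 : ℝ)..L, ‖f s‖ ^ 2) := by
  have hmem : MemLp f 2 (volume.restrict (Ioc 0 L)) := by
    obtain ⟨C, hC⟩ := (isCompact_Icc (a := (0 : ℝ)) (b := L)).exists_bound_of_continuousOn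
      hf.continuousOn
    refine MemLp.of_bound hf.aestronglyMeasurable C ?_
    filter_upwards [ae_restrict_mem measurableSet_Ioc] with s hs
    exact hC s (Ioc_subset_Icc_self hs)
  simpa using hasSum_sq_fourierCoeffOn hL hmem

lemma fourierCoeffOn_add_const_mul {L : ℝ} (hL : 0 < L) {f g : ℝ → ℂ} (hf : Continuous f)
    (hg : Continuous g) (c : ℂ) (k : ℤ) :
    fourierCoeffOn hL (fun s => f s + c * g s) k =
      fourierCoeffOn hL f k + c * fourierCoeffOn hL g k := by
  have hc : Continuous fun x : ℝ => (fourier (-k) (x : AddCircle (L - 0)) : ℂ) :=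
    (map_continuous _).comp (AddCircle.continuous_mk' _)
  simp only [fourierCoeffOn_eq_integral, smul_eq_mul, mul_add]
  have h := intervalIntegral.integral_add (μ := volume) (a := 0) (b := L)
    ((hc.mul hf).intervalIntegrable _ _)
    ((hc.mul ((continuous_const (y := c)).mul hg)).intervalIntegrable _ _)
  simp only [Pi.mul_apply] at h
  rw [h, smul_add, mul_smul_comm, ← intervalIntegral.integral_const_mul]
  simp only [mul_left_comm c]

lemma HasSum.of_eq {f g : ℤ → ℝ} {a b : ℝ} (h : HasSum f a) (hfg : ∀ k, g k = f k)
    (hab : b = a) : HasSum g b := by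
  rwa [funext hfg, hab]

lemma norm_two_pi_I_mul_div {L : ℝ} (hL : 0 < L) (k : ℤ) :
    ‖(2 * Real.pi * I * k / L : ℂ)‖ = |(k : ℝ)| / (L / (2 * Real.pi)) := by
  have := Real.pi_pos
  simp only [norm_div, norm_mul, Complex.norm_I, Complex.norm_intCast, Complex.norm_real,
    Real.norm_eq_abs, abs_of_pos hL, abs_of_pos Real.pi_pos, Complex.norm_ofNat]
  field_simp

/-! ### The polynomials `P_m` and `S_m` -/

/-- The value at `x` of `P_m`, over the reals. -/
noncomputable def realP (m : ℕ) (x : ℝ) : ℝ := ∏ j ∈ Finset.Icc 2 m, (x - (j : ℝ) ^ 2)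

lemma eval_map_polyP (m : ℕ) (x : ℝ) :
    ((polyP m).map (Int.castRingHom ℝ)).eval x = realP m x := by
  simp [polyP, realP, Polynomial.map_prod, Polynomial.eval_prod]

lemma intCast_eval_one_polyP (m : ℕ) : (((polyP m).eval 1 : ℤ) : ℝ) = realP m 1 := by
  simp [polyP, realP, Polynomial.eval_prod]

lemma sub_one_mul_polyS (m : ℕ) :
    (Polynomial.X - Polynomial.C 1) * polyS m = polyP m - Polynomial.C ((polyP m).eval 1) := by
  rw [polyS, Polynomial.mul_divByMonic_eq_iff_isRoot]
  simp [Polynomial.IsRoot]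

lemma natDegree_polyS (m : ℕ) : (polyS m).natDegree ≤ m - 2 := by
  rw [polyS, Polynomial.natDegree_divByMonic _ (Polynomial.monic_X_sub_C 1),
    Polynomial.natDegree_sub_C, polyP, Polynomial.natDegree_prod_of_monic]
  · simp only [Polynomial.natDegree_X_sub_C, Finset.sum_const, Nat.card_Icc, smul_eq_mul]
    omega
  · exact fun j _ => Polynomial.monic_X_sub_C _

lemma sub_one_mul_sum_sCoeff (m : ℕ) (x : ℝ) :
    (x - 1) * ∑ l ∈ Finset.Icc 1 (m - 1), (sCoeff m l : ℝ) * x ^ (l - 1) =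
      realP m x - realP m 1 := by
  rcases Nat.lt_or_ge m 2 with hm | hm
  · interval_cases m <;> simp [realP]
  have h1 : ∑ l ∈ Finset.Icc 1 (m - 1), (sCoeff m l : ℝ) * x ^ (l - 1) =
      ((polyS m).map (Int.castRingHom ℝ)).eval x := by
    have hdeg : ((polyS m).map (Int.castRingHom ℝ)).natDegree < m - 1 :=
      (Polynomial.natDegree_map_le.trans (natDegree_polyS m)).trans_lt (by omega)
    rw [Polynomial.eval_eq_sum_range' hdeg, Finset.sum_bij' (fun l _ => l - 1) (fun i _ => i + 1)]
    · intro l hl; simp only [Finset.mem_Icc, Finset.mem_range] at hl ⊢; omega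
    · intro l hl; simp only [Finset.mem_Icc, Finset.mem_range] at hl ⊢; omega
    · intro l hl; simp only [Finset.mem_Icc] at hl; omega
    · intro l hl; simp
    · intro l hl; simp [sCoeff]
  have h2 := congrArg (fun p => (p.map (Int.castRingHom ℝ)).eval x) (sub_one_mul_polyS m)
  rw [Polynomial.map_mul, Polynomial.map_sub, Polynomial.map_sub, Polynomial.map_X,
    Polynomial.map_C, Polynomial.map_C, Polynomial.eval_mul, Polynomial.eval_sub,
    Polynomial.eval_sub, Polynomial.eval_X, Polynomial.eval_C, Polynomial.eval_C, eval_map_polyP,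
    eq_intCast, eq_intCast, Int.cast_one, intCast_eval_one_polyP] at h2
  rw [h1, h2]

/-- `P_m(1) = ∏_{j=2}^m (1 - j)(1 + j)`, written with factorials. -/
lemma realP_one {m : ℕ} (hm : 1 ≤ m) :
    realP m 1 = -((-1) ^ m / 2 * ((m - 1).factorial : ℝ) * ((m + 1).factorial : ℝ)) := by
  induction m, hm using Nat.le_induction with
  | base => norm_num [realP]
  | succ m hm ih =>
    rw [realP, Finset.prod_Icc_succ_top (by omega), ← realP, ih]
    obtain ⟨k, rfl⟩ : ∃ k, m = k + 1 := ⟨m - 1, by omega⟩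
    simp only [Nat.add_sub_cancel]
    rw [Nat.factorial_succ (k + 1 + 1), Nat.factorial_succ k]
    push_cast
    ring

/-! ### The form as a weighted sum over frequencies -/

/-- Parseval's identity for the `l`-th integral of the form. -/
lemma hasSum_integral_iteratedDeriv {m l : ℕ} (hl : l + 2 ≤ m) {L : ℝ} (hL : 0 < L) {z : ℝ → ℂ}
    (hz : ContDiff ℝ m z) (hper : Function.Periodic z L) :
    HasSum (fun k : ℤ => (L / (2 * Real.pi)) ^ (-(1 : ℤ)) * L *
        (((k : ℝ) ^ 2) ^ l * ((k : ℝ) ^ 2 - 1) ^ 2 * ‖fourierCoeffOn hL z k‖ ^ 2))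
      ((L / (2 * Real.pi)) ^ (2 * ((l + 1 : ℕ) : ℤ) - 3) * ∫ s in (0 : ℝ)..L, ‖iteratedDeriv l
        (fun u => z u + ((L / (2 * Real.pi) : ℝ) : ℂ) ^ 2 * curvatureVector z u) s‖ ^ 2) := by
  set R := L / (2 * Real.pi) with hR
  have hRpos : 0 < R := by positivity
  have hz2 : ContDiff ℝ ((l : WithTop ℕ∞) + 1 + 1) z :=
    hz.of_le (by exact_mod_cast (show l + 1 + 1 ≤ m by omega))
  have hz1' := (contDiff_succ_iff_deriv.1 hz2).2.2
  have hz0' := (contDiff_succ_iff_deriv.1 hz1').2.2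
  have hzl : ContDiff ℝ (l : WithTop ℕ∞) z := hz2.of_le (by
    exact_mod_cast (show l ≤ l + 1 + 1 by omega))
  set g : ℝ → ℂ := fun u => z u + ((R : ℝ) : ℂ) ^ 2 * curvatureVector z u with hg
  have hgC : ContDiff ℝ (l : WithTop ℕ∞) g := hzl.add (contDiff_const.mul hz0')
  have hgper : Function.Periodic g L := fun s => by
    simp only [hg, curvatureVector, hper s, hper.deriv'.deriv' s]
  have hgk : ∀ k, fourierCoeffOn hL g k = (1 - (k : ℂ) ^ 2) * fourierCoeffOn hL z k := by
    intro k
    have hadd := fourierCoeffOn_add_const_mul hL hzl.continuous hz0'.continuous ((R : ℂ) ^ 2) k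
    rw [show g = fun s => z s + (R : ℂ) ^ 2 * deriv (deriv z) s from rfl, hadd,
      fourierCoeffOn_deriv hL (hz1'.of_le (by simp)) hper.deriv',
      fourierCoeffOn_deriv hL (hz2.of_le (by simp)) hper, hR]
    have hLc : (L : ℂ) ≠ 0 := by exact_mod_cast hL.ne'
    have hpi : (Real.pi : ℂ) ≠ 0 := by exact_mod_cast Real.pi_ne_zero
    push_cast
    field_simp
    linear_combination (k : ℂ) ^ 2 * fourierCoeffOn hL z k * Complex.I_sq
  have hP := (hasSum_sq_fourierCoeffOn_of_continuous hL
    (hgC.continuous_iteratedDeriv l le_rfl)).mul_left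
      (R ^ (2 * ((l + 1 : ℕ) : ℤ) - 3) * L)
  have hexp : R ^ (2 * ((l + 1 : ℕ) : ℤ) - 3) = R ^ (-(1 : ℤ)) * R ^ (2 * l) := by
    rw [← zpow_natCast R (2 * l), ← zpow_add₀ hRpos.ne']
    congr 1
    push_cast
    ring
  refine hP.of_eq (fun k => ?_) ?_
  · rw [fourierCoeffOn_iteratedDeriv hL l hgC hgper, hgk, norm_mul, norm_mul, norm_pow, hexp]
    have h2 : ‖(1 - (k : ℂ) ^ 2)‖ ^ 2 = ((k : ℝ) ^ 2 - 1) ^ 2 := by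
      have : (1 - (k : ℂ) ^ 2) = ((1 - (k : ℝ) ^ 2 : ℝ) : ℂ) := by push_cast; ring
      rw [this, Complex.norm_real, Real.norm_eq_abs, sq_abs]
      ring
    have h3 : R ^ (2 * l) * ((|(k : ℝ)| / R) ^ l) ^ 2 = ((k : ℝ) ^ 2) ^ l := by
      have h4 : R * (|(k : ℝ)| / R) = |(k : ℝ)| := by field_simp
      rw [← pow_mul, mul_comm l 2, ← mul_pow, h4, pow_mul, sq_abs]
    rw [mul_pow, mul_pow, norm_two_pi_I_mul_div hL, ← hR, h2, ← h3]
    ring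
  · field_simp

/-- With `R = L / 2π` and `a_k` the Fourier coefficients of `z`, the form is
`(L / R) ∑ (k² - 1) P_m(k²) |a_k|²`. The area drops out: by Green's formula it is the cross term
in the expansion of `|z - R n|²`. -/
theorem hasSum_higherIsoperimetricForm {m : ℕ} (hm : 1 ≤ m) {L : ℝ} {z : ℝ → ℂ} {F : ℝ}
    (hz : IsSimpleClosedUnitSpeedCurve m L z) {n : ℝ → ℂ} (hn : ∀ s, n s = -I * deriv z s)
    (hF : 2 * I * F = ∫ s in (0 : ℝ)..L, (starRingEnd ℂ) (z s) * deriv z s) :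
    HasSum (fun k : ℤ => (L / (2 * Real.pi)) ^ (-(1 : ℤ)) * L * (((k : ℝ) ^ 2 - 1) *
        realP m ((k : ℝ) ^ 2) * ‖fourierCoeffOn hz.length_pos z k‖ ^ 2))
      (higherIsoperimetricForm m L z n F) := by
  have hL := hz.length_pos
  have hz1 : ContDiff ℝ 1 z := hz.contDiff.of_le (by exact_mod_cast hm)
  have hcd := hz1.continuous_deriv le_rfl
  set R := L / (2 * Real.pi) with hR
  have hRpos : 0 < R := by positivity
  have hpi := Real.pi_pos
  have h0 := hasSum_sq_fourierCoeffOn_of_continuous hL hz1.continuous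
  have h1 : HasSum (fun k : ℤ => (k : ℝ) ^ 2 * ‖fourierCoeffOn hL z k‖ ^ 2) (R ^ 2) := by
    have h := (hasSum_sq_fourierCoeffOn_of_continuous hL hcd).mul_left (R ^ 2)
    simp only [hz.unit_speed, one_pow, intervalIntegral.integral_const, sub_zero, smul_eq_mul,
      mul_one, inv_mul_cancel₀ hL.ne'] at h
    refine h.of_eq (fun k => ?_) rfl
    rw [fourierCoeffOn_deriv hL hz1 hz.periodic, norm_mul, mul_pow]
    rw [norm_two_pi_I_mul_div hL, ← hR, ← sq_abs (k : ℝ)]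
    field_simp
  have hJ : ∫ s in (0 : ℝ)..L, ‖z s - (R : ℂ) * n s‖ ^ 2 =
      (∫ s in (0 : ℝ)..L, ‖z s‖ ^ 2) - 4 * R * F + R ^ 2 * L := by
    have hpt : ∀ s, ‖z s - (R : ℂ) * n s‖ ^ 2 =
        ‖z s‖ ^ 2 - 2 * R * ((starRingEnd ℂ) (z s) * deriv z s).im + R ^ 2 := by
      intro s
      have hu := hz.unit_speed s
      have hu2 : (deriv z s).re ^ 2 + (deriv z s).im ^ 2 = 1 := by
        have := Complex.sq_norm (deriv z s)
        rw [hu, Complex.normSq_apply] at this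
        linarith
      rw [Complex.sq_norm, Complex.sq_norm, Complex.normSq_apply, Complex.normSq_apply, hn]
      simp
      linear_combination R ^ 2 * hu2
    have hcross : Continuous fun s => (starRingEnd ℂ) (z s) * deriv z s :=
      (Complex.continuous_conj.comp hz1.continuous).mul hcd
    have him : ∫ s in (0 : ℝ)..L, ((starRingEnd ℂ) (z s) * deriv z s).im = 2 * F := by
      have h := Complex.imCLM.intervalIntegral_comp_comm
        (hcross.intervalIntegrable (μ := volume) 0 L)
      simp only [Complex.imCLM_apply] at h
      rw [h, ← hF]
      simp
    simp only [hpt]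
    rw [intervalIntegral.integral_add, intervalIntegral.integral_sub,
      intervalIntegral.integral_const_mul, him, intervalIntegral.integral_const]
    · simp only [sub_zero, smul_eq_mul]
      ring
    · exact (hz1.continuous.norm.pow 2).intervalIntegrable _ _
    · exact (continuous_const.mul (Complex.continuous_im.comp hcross)).intervalIntegrable _ _
    · exact ((hz1.continuous.norm.pow 2).sub (continuous_const.mul
        (Complex.continuous_im.comp hcross))).intervalIntegrable _ _
    · exact continuous_const.intervalIntegrable _ _
  have hsum := hasSum_sum (s := Finset.Icc 1 (m - 1))
    (f := fun (l : ℕ) (k : ℤ) => (sCoeff m l : ℝ) * (R ^ (-(1 : ℤ)) * L *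
      (((k : ℝ) ^ 2) ^ (l - 1) * ((k : ℝ) ^ 2 - 1) ^ 2 * ‖fourierCoeffOn hL z k‖ ^ 2)))
    (a := fun l => (sCoeff m l : ℝ) * R ^ (2 * (l : ℤ) - 3) * ∫ s in (0 : ℝ)..L,
      ‖iteratedDeriv (l - 1) (fun u => z u + (R : ℂ) ^ 2 * curvatureVector z u) s‖ ^ 2)
    (fun l hl => by
      rw [Finset.mem_Icc] at hl
      have h := (hasSum_integral_iteratedDeriv (l := l - 1) (m := m) (by omega) hL hz.contDiff
        hz.periodic).mul_left (sCoeff m l : ℝ)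
      rw [← hR, Nat.sub_add_cancel hl.1, ← mul_assoc] at h
      exact h)
  have htot := hsum.add ((h1.sub h0).mul_left (realP m 1 * (R ^ (-(1 : ℤ)) * L)))
  refine htot.of_eq (fun k => ?_) ?_
  · have hS := sub_one_mul_sum_sCoeff m ((k : ℝ) ^ 2)
    have : ∀ l, (sCoeff m l : ℝ) * (R ^ (-(1 : ℤ)) * L *
        (((k : ℝ) ^ 2) ^ (l - 1) * ((k : ℝ) ^ 2 - 1) ^ 2 * ‖fourierCoeffOn hL z k‖ ^ 2)) =
        ((sCoeff m l : ℝ) * ((k : ℝ) ^ 2) ^ (l - 1)) * (R ^ (-(1 : ℤ)) * L *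
          (((k : ℝ) ^ 2 - 1) ^ 2 * ‖fourierCoeffOn hL z k‖ ^ 2)) := fun l => by ring
    rw [Finset.sum_congr rfl fun l _ => this l, ← Finset.sum_mul]
    linear_combination -(R ^ (-(1 : ℤ)) * L * ((k : ℝ) ^ 2 - 1) *
      ‖fourierCoeffOn hL z k‖ ^ 2) * hS
  · rw [higherIsoperimetricForm, ← hR, hJ, realP_one hm, sub_eq_add_neg]
    congr 1
    have hLR : L = R * (2 * Real.pi) := by rw [hR]; field_simp
    rw [zpow_neg_one]
    generalize (∫ s in (0 : ℝ)..L, ‖z s‖ ^ 2) = A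
    rw [hLR]
    field_simp
    ring

/-! ### Signs of the weights -/

lemma realP_sq_eq_zero {m : ℕ} {k : ℤ} (h1 : 2 ≤ |k|) (h2 : |k| ≤ m) :
    realP m ((k : ℝ) ^ 2) = 0 := by
  refine Finset.prod_eq_zero (i := k.natAbs) ?_ ?_
  · have := Int.abs_eq_natAbs k
    rw [Finset.mem_Icc]
    omega
  · rw [sub_eq_zero, Nat.cast_natAbs, Int.cast_abs, sq_abs]

lemma realP_sq_pos {m : ℕ} {k : ℤ} (h : (m : ℤ) < |k|) : 0 < realP m ((k : ℝ) ^ 2) := by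
  refine Finset.prod_pos fun j hj => ?_
  rw [Finset.mem_Icc] at hj
  have h1 : ((j : ℤ) : ℝ) < ((|k| : ℤ) : ℝ) := by exact_mod_cast (show (j : ℤ) < |k| by omega)
  rw [Int.cast_abs, Int.cast_natCast] at h1
  rw [sub_pos, ← sq_abs (k : ℝ)]
  exact pow_lt_pow_left₀ h1 (by positivity) two_ne_zero

lemma sq_sub_one_pos {k : ℤ} (h : 1 < |k|) : 0 < (k : ℝ) ^ 2 - 1 := by
  have h1 : (1 : ℝ) < |(k : ℝ)| := by exact_mod_cast h
  rw [sub_pos, ← sq_abs]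
  exact one_lt_pow₀ h1 two_ne_zero

/-- The weights of the form vanish for `1 ≤ |k| ≤ m`. -/
lemma weight_eq_zero {m : ℕ} {k : ℤ} (h0 : k ≠ 0) (h : |k| ≤ m) :
    ((k : ℝ) ^ 2 - 1) * realP m ((k : ℝ) ^ 2) = 0 := by
  rcases eq_or_ne |k| 1 with h1 | h1
  · have : |(k : ℝ)| = 1 := by exact_mod_cast h1
    rw [← sq_abs, this]
    simp
  · have := abs_pos.2 h0
    rw [realP_sq_eq_zero (by omega) h, mul_zero]

/-- The weights of the form are positive for `|k| > m`. -/
lemma weight_pos {m : ℕ} (hm : 1 ≤ m) {k : ℤ} (h : (m : ℤ) < |k|) :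
    0 < ((k : ℝ) ^ 2 - 1) * realP m ((k : ℝ) ^ 2) :=
  mul_pos (sq_sub_one_pos (by omega)) (realP_sq_pos h)

/-! ### Unit-speed trigonometric polynomials -/

/-- A polynomial of constant modulus one on the unit circle is a monomial: `Q` times its
conjugate reciprocal polynomial is a power of `X`. -/
lemma Polynomial.eq_C_mul_X_pow_of_norm_eval_eq_one {Q : Polynomial ℂ}
    (hQ : ∀ ω : ℂ, ‖ω‖ = 1 → ‖Q.eval ω‖ = 1) :
    ∃ (c : ℂ) (j : ℕ), Q = Polynomial.C c * Polynomial.X ^ j := by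
  set S : Polynomial ℂ := (Q.map (starRingEnd ℂ)).reverse with hS
  set N := (Q.map (starRingEnd ℂ)).natDegree with hN
  have heval : ∀ ω : ℂ, ‖ω‖ = 1 → (Q * S).eval ω = (Polynomial.X ^ N : Polynomial ℂ).eval ω := by
    intro ω hω
    have hω0 : ω ≠ 0 := by
      rintro rfl
      simp at hω
    have hconj : (starRingEnd ℂ) ω = ω⁻¹ := by
      rw [Complex.inv_def, Complex.normSq_eq_norm_sq, hω]
      simp
    let inv : Invertible (ω⁻¹) := invertibleOfNonzero (inv_ne_zero hω0)
    have h := Polynomial.eval₂_reverse_mul_pow (RingHom.id ℂ) (ω⁻¹) (Q.map (starRingEnd ℂ))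
    rw [invOf_eq_inv, inv_inv, Polynomial.eval₂_id, Polynomial.eval₂_id, ← hconj,
      Polynomial.eval_map, Polynomial.eval₂_at_apply, hconj, ← hS, ← hN, inv_pow] at h
    have hQω : Q.eval ω * (starRingEnd ℂ) (Q.eval ω) = 1 := by
      rw [Complex.mul_conj, Complex.normSq_eq_norm_sq, hQ ω hω]
      simp
    rw [Polynomial.eval_mul, Polynomial.eval_pow, Polynomial.eval_X]
    have hp : ω ^ N ≠ 0 := pow_ne_zero _ hω0
    rw [← h] at hQω
    field_simp at hQω
    exact hQω
  have hinf : Set.Infinite {ω : ℂ | (Q * S).eval ω = (Polynomial.X ^ N : Polynomial ℂ).eval ω} := by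
    refine Set.Infinite.mono (s := range fun t : ↥(Ioo (0 : ℝ) 1) => Complex.exp (t * I)) ?_ ?_
    · rintro _ ⟨t, rfl⟩
      exact heval _ (Complex.norm_exp_ofReal_mul_I t)
    · have : Infinite ↥(Ioo (0 : ℝ) 1) := (Ioo_infinite zero_lt_one).to_subtype
      refine infinite_range_of_injective fun s t hst => Subtype.ext ?_
      have hpi := Real.pi_gt_three
      have h : Complex.arg (Complex.exp (s * I)) = Complex.arg (Complex.exp (t * I)) :=
        congrArg Complex.arg hst
      rwa [Complex.arg_exp_mul_I, Complex.arg_exp_mul_I,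
        (toIocMod_eq_self _).2 ⟨by linarith [s.2.1], by linarith [s.2.2]⟩,
        (toIocMod_eq_self _).2 ⟨by linarith [t.2.1], by linarith [t.2.2]⟩] at h
  have hmul := Polynomial.eq_of_infinite_eval_eq _ _ hinf
  obtain ⟨j, -, hj⟩ := (dvd_prime_pow Polynomial.prime_X N).1 ⟨S, hmul.symm⟩
  obtain ⟨u, hu⟩ := hj.symm
  obtain ⟨c, -, hc⟩ := Polynomial.isUnit_iff.1 u.isUnit
  exact ⟨c, j, by rw [← hu, ← hc, mul_comm]⟩

/-- A continuous periodic function with finitely many Fourier coefficients is a trigonometric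
polynomial. -/
lemma eq_sum_of_fourierCoeffOn_eq_zero {L : ℝ} (hL : 0 < L) {f : ℝ → ℂ} (hf : Continuous f)
    (hper : Function.Periodic f L) (S : Finset ℤ) (hS : ∀ k ∉ S, fourierCoeffOn hL f k = 0)
    (s : ℝ) :
    f s = ∑ k ∈ S, fourierCoeffOn hL f k * Complex.exp (2 * Real.pi * I * k * s / L) := by
  have : Fact (0 < L) := ⟨hL⟩
  set F : C(AddCircle L, ℂ) := ⟨hper.lift, continuous_coinduced_dom.2 hf⟩ with hF
  have hcoef : ∀ k, fourierCoeff F k = fourierCoeffOn hL f k := by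
    intro k
    rw [fourierCoeff_eq_intervalIntegral _ _ 0, fourierCoeffOn_eq_integral, zero_add, sub_zero]
    congr 1
  have hsummable : Summable (fourierCoeff F) :=
    summable_of_ne_finset_zero (s := S) fun k hk => by rw [hcoef, hS k hk]
  have h1 := has_pointwise_sum_fourier_series_of_summable hsummable (s : AddCircle L)
  have h3 := h1.unique (hasSum_sum_of_ne_finset_zero (s := S) fun k hk => by
    rw [hcoef, hS k hk, zero_smul])
  rw [show F (s : AddCircle L) = f s from rfl] at h3
  rw [h3]
  simp only [hcoef, fourier_coe_apply, smul_eq_mul]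

/-- A unit-speed trigonometric velocity has a single frequency. -/
lemma exists_deriv_eq_exp {m : ℕ} {L : ℝ} (hL : 0 < L) {v : ℝ → ℂ} (hv : Continuous v)
    (hper : Function.Periodic v L) (hnorm : ∀ s, ‖v s‖ = 1)
    (hcoef : ∀ k : ℤ, (m : ℤ) < |k| → fourierCoeffOn hL v k = 0) :
    ∃ (c : ℂ) (p : ℤ), ∀ s : ℝ, v s = c * Complex.exp (2 * Real.pi * I * p * s / L) := by
  have hLc : (L : ℂ) ≠ 0 := by exact_mod_cast hL.ne'
  have hpi : (Real.pi : ℂ) ≠ 0 := by exact_mod_cast Real.pi_ne_zero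
  set Q : Polynomial ℂ := ∑ k ∈ Finset.Icc (-(m : ℤ)) m,
    Polynomial.C (fourierCoeffOn hL v k) * Polynomial.X ^ (k + m).toNat with hQdef
  have hsum := eq_sum_of_fourierCoeffOn_eq_zero hL hv hper (Finset.Icc (-(m : ℤ)) m)
    fun k hk => hcoef k (by
      by_contra! h
      exact hk (Finset.mem_Icc.2 (abs_le.1 h)))
  -- The shift by `m` clears the negative frequencies.
  have hQ : ∀ s : ℝ, Q.eval (Complex.exp (2 * Real.pi * I * s / L)) =
      v s * Complex.exp (2 * Real.pi * I * s / L) ^ m := by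
    intro s
    rw [hsum s, hQdef, Polynomial.eval_finsetSum, Finset.sum_mul]
    refine Finset.sum_congr rfl fun k hk => ?_
    rw [Finset.mem_Icc] at hk
    rw [Polynomial.eval_mul, Polynomial.eval_C, Polynomial.eval_pow, Polynomial.eval_X,
      ← Complex.exp_nat_mul, ← Complex.exp_nat_mul, mul_assoc (fourierCoeffOn hL v k),
      ← Complex.exp_add]
    congr 2
    have : (((k + m).toNat : ℕ) : ℂ) = k + m := by
      have := Int.toNat_of_nonneg (show 0 ≤ k + m by omega)
      exact_mod_cast congrArg (Int.cast : ℤ → ℂ) this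
    rw [this]
    ring
  have hexpn : ∀ s : ℝ, ‖Complex.exp (2 * Real.pi * I * s / L)‖ = 1 := by
    intro s
    have : (2 * Real.pi * I * s / L : ℂ) = ((2 * Real.pi * s / L : ℝ) : ℂ) * I := by
      push_cast
      ring
    rw [this, Complex.norm_exp_ofReal_mul_I]
  obtain ⟨c, j, hcj⟩ := Polynomial.eq_C_mul_X_pow_of_norm_eval_eq_one (Q := Q) fun ω hω => by
    have hω' : ω = Complex.exp (2 * Real.pi * I * ((L * ω.arg / (2 * Real.pi) : ℝ) : ℂ) / L) := by
      have h := Complex.norm_mul_exp_arg_mul_I ω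
      rw [hω, Complex.ofReal_one, one_mul] at h
      rw [← h]
      congr 1
      rw [h]
      push_cast
      field_simp
    rw [hω', hQ, norm_mul, norm_pow, hnorm, hexpn, one_pow, mul_one]
  refine ⟨c, (j : ℤ) - m, fun s => ?_⟩
  have h := hQ s
  rw [hcj, Polynomial.eval_mul, Polynomial.eval_C, Polynomial.eval_pow, Polynomial.eval_X] at h
  have hne : Complex.exp (2 * Real.pi * I * s / L) ^ m ≠ 0 := pow_ne_zero _ (Complex.exp_ne_zero _)
  apply mul_right_cancel₀ hne
  rw [← h, mul_assoc c, ← Complex.exp_nat_mul, ← Complex.exp_nat_mul, ← Complex.exp_add]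
  congr 2
  push_cast
  ring

lemma hasDerivAt_exp_mul_div (L : ℝ) (p : ℤ) (s : ℝ) :
    HasDerivAt (fun s : ℝ => Complex.exp (2 * Real.pi * I * p * s / L))
      (2 * Real.pi * I * p / L * Complex.exp (2 * Real.pi * I * p * s / L)) s := by
  have h1 : HasDerivAt (fun s : ℝ => (2 * Real.pi * I * p * s / L : ℂ))
      (2 * Real.pi * I * p / L) s := by
    have := ((Complex.ofRealCLM.hasDerivAt (x := s)).const_mul
      (2 * Real.pi * I * p : ℂ)).div_const (L : ℂ)
    simpa using this
  exact h1.cexp.congr_deriv (mul_comm _ _)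

/-- A centred simple closed curve whose velocity has a single frequency is a circle run through
once, in one of the two directions. -/
lemma IsSimpleClosedUnitSpeedCurve.exists_eq_exp {m : ℕ} (hm : 1 ≤ m) {L : ℝ} {z : ℝ → ℂ}
    (hz : IsSimpleClosedUnitSpeedCurve m L z) (hmean : ∫ s in (0 : ℝ)..L, z s = 0) {c : ℂ} {p : ℤ}
    (hc : ∀ s : ℝ, deriv z s = c * Complex.exp (2 * Real.pi * I * p * s / L)) :
    ∃ b : ℂ, |p| = 1 ∧ ∀ s : ℝ, z s = b * Complex.exp (2 * Real.pi * I * p * s / L) := by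
  have hL := hz.length_pos
  have hz1 : ContDiff ℝ 1 z := hz.contDiff.of_le (by exact_mod_cast hm)
  have hLc : (L : ℂ) ≠ 0 := by exact_mod_cast hL.ne'
  have hpi : (Real.pi : ℂ) ≠ 0 := by exact_mod_cast Real.pi_ne_zero
  have hzL : z L = z 0 := by simpa using hz.periodic 0
  have hint : ∫ s in (0 : ℝ)..L, deriv z s = 0 := by
    rw [intervalIntegral.integral_eq_sub_of_hasDerivAt
      (fun s _ => (hz1.differentiable one_ne_zero s).hasDerivAt)
      ((hz1.continuous_deriv le_rfl).intervalIntegrable _ _), hzL, sub_self]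
  have hp : p ≠ 0 := by
    rintro rfl
    simp only [hc, Int.cast_zero, mul_zero, zero_mul, zero_div, Complex.exp_zero, mul_one,
      intervalIntegral.integral_const, sub_zero, Complex.real_smul] at hint
    have hc0 : c = 0 := by simpa [hLc] using hint
    have := hz.unit_speed 0
    rw [hc 0, hc0] at this
    simp at this
  have hpc : (p : ℂ) ≠ 0 := by exact_mod_cast hp
  have hI := I_ne_zero
  set a : ℂ := 2 * Real.pi * I * p / L with ha
  have ha0 : a ≠ 0 := by
    rw [ha]
    exact div_ne_zero (by simp [hpi, hpc]) hLc
  have hderiv : ∀ s, HasDerivAt (fun s => z s - a⁻¹ * deriv z s) 0 s := by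
    intro s
    have h1 := (hasDerivAt_exp_mul_div L p s).const_mul (a⁻¹ * c)
    have h2 := ((hz1.differentiable one_ne_zero s).hasDerivAt.sub h1).congr_deriv
      (show deriv z s - _ = 0 by rw [hc s, ← ha]; field_simp; ring)
    refine h2.congr_of_eventuallyEq (Eventually.of_forall fun t => ?_)
    simp only [Pi.sub_apply, hc t]
    ring
  have hconst : ∀ s, z s - a⁻¹ * deriv z s = z 0 - a⁻¹ * deriv z 0 := fun s =>
    is_const_of_deriv_eq_zero (fun s => (hderiv s).differentiableAt) (fun s => (hderiv s).deriv) s 0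
  -- The centroid condition removes the constant of integration.
  have hd : z 0 - a⁻¹ * deriv z 0 = 0 := by
    have h : ∫ s in (0 : ℝ)..L, (z s - a⁻¹ * deriv z s) = 0 := by
      rw [intervalIntegral.integral_sub (hz1.continuous.intervalIntegrable _ _)
        (((hz1.continuous_deriv le_rfl).const_mul a⁻¹).intervalIntegrable _ _),
        intervalIntegral.integral_const_mul, hint, hmean, mul_zero, sub_zero]
    simp only [hconst, intervalIntegral.integral_const, sub_zero, Complex.real_smul] at h
    exact (mul_eq_zero.1 h).resolve_left hLc
  have hform : ∀ s : ℝ, z s = a⁻¹ * c * Complex.exp (2 * Real.pi * I * p * s / L) := by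
    intro s
    have := hconst s
    rw [hd, sub_eq_zero, hc] at this
    rw [this, ← mul_assoc]
  refine ⟨a⁻¹ * c, ?_, hform⟩
  by_contra hne
  have hp2 : 2 ≤ |p| := by
    have := abs_pos.2 hp
    omega
  have hpR : (2 : ℝ) ≤ |(p : ℝ)| := by exact_mod_cast hp2
  -- Frequencies of absolute value at least two return to the starting point too early.
  have hper : z (L / |(p : ℝ)|) = z 0 := by
    rw [hform, hform]
    congr 1
    rw [Complex.exp_eq_exp_iff_exists_int]
    have hpa : (|(p : ℝ)| : ℝ) = ((|p| : ℤ) : ℝ) := by push_cast; rfl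
    refine ⟨Int.sign p, ?_⟩
    have hs : ((Int.sign p : ℤ) : ℂ) * ((|p| : ℤ) : ℂ) = p := by
      exact_mod_cast congrArg (Int.cast : ℤ → ℂ) (Int.sign_mul_abs p)
    have hpa0 : ((|p| : ℤ) : ℂ) ≠ 0 := by exact_mod_cast (abs_pos.2 hp).ne'
    rw [hpa]
    push_cast [-Int.cast_abs]
    rw [← hs]
    field_simp
    ring
  have hlt : L / |(p : ℝ)| < L := div_lt_self hL (by linarith)
  have hpos : 0 < L / |(p : ℝ)| := by positivity
  exact hpos.ne' (hz.injOn ⟨hpos.le, hlt⟩ ⟨le_rfl, hL⟩ hper)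

/-! ### The inequality and its equality case -/

/-- The orientation hypotheses determine the outward normal. -/
lemma IsOutwardUnitNormal.eq_neg_I_mul_deriv {z : ℝ → ℂ} {Ω : Set ℂ} {n : ℝ → ℂ}
    (hn : IsOutwardUnitNormal z Ω n) (hleft : IsCounterclockwise z Ω)
    (hspeed : ∀ s, ‖deriv z s‖ = 1) (s : ℝ) : n s = -I * deriv z s := by
  have hτ : (starRingEnd ℂ) (deriv z s) * deriv z s = 1 := by
    rw [← Complex.normSq_eq_conj_mul_self, Complex.normSq_eq_norm_sq, hspeed]
    norm_num
  set w := n s * (starRingEnd ℂ) (deriv z s) with hw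
  have hnw : n s = w * deriv z s := by
    rw [hw, mul_assoc, hτ, mul_one]
  have hre : w.re = 0 := by
    have := hn.orthogonal s
    rw [Complex.inner, hw] at *
    simp at this ⊢
    linarith
  have hnorm : ‖w‖ = 1 := by
    rw [hw, norm_mul, hn.norm_eq_one, RCLike.norm_conj, hspeed, mul_one]
  have him : w.im = 1 ∨ w.im = -1 := by
    have h := Complex.sq_norm w
    rw [hnorm, Complex.normSq_apply, hre] at h
    exact mul_self_eq_one_iff.1 (by linarith)
  rcases him with h | h
  · exfalso
    have hwI : w = I := Complex.ext (by simp [hre]) (by simp [h])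
    obtain ⟨ε, h1, h2⟩ := ((hn.outward s).and (hleft s)).exists
    rw [hnw, hwI] at h1
    exact h1 (subset_closure h2)
  · have hwI : w = -I := Complex.ext (by simp [hre]) (by simp [h])
    rw [hnw, hwI]

theorem mainTheorem2 (m : ℕ) (hm : 1 ≤ m) (L : ℝ) (z : ℝ → ℂ) (Ω : Set ℂ) (n : ℝ → ℂ)
    (hz : IsSimpleClosedUnitSpeedCurve m L z)
    (hΩ : IsEnclosedDomain z Ω)
    (hccw : IsCounterclockwise z Ω)
    (hn : IsOutwardUnitNormal z Ω n)
    (hcentroid : curveCentroid L z = 0) :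
    0 ≤ higherIsoperimetricForm m L z n (volume.real Ω) ∧
      (higherIsoperimetricForm m L z n (volume.real Ω) = 0 ↔
        ∃ b : ℂ, ∀ s : ℝ, z s = b * Complex.exp (Complex.I * ((2 * Real.pi / L * s : ℝ) : ℂ))) := by
  have hL := hz.length_pos
  have hpi := Real.pi_pos
  have hLc : (L : ℂ) ≠ 0 := by exact_mod_cast hL.ne'
  have hz1 : ContDiff ℝ 1 z := hz.contDiff.of_le (by exact_mod_cast hm)
  have hnormal := hn.eq_neg_I_mul_deriv hccw hz.unit_speed
  have hright : ∀ s, ∀ᶠ ε : ℝ in 𝓝[>] 0, z s - (ε : ℂ) * (I * deriv z s) ∉ Ω := by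
    intro s
    filter_upwards [hn.outward s] with ε hε hmem
    rw [hnormal s] at hε
    refine hε (subset_closure ?_)
    convert hmem using 1
    ring
  have harea := hz.area_eq hm hΩ hccw hright
  have hsum := hasSum_higherIsoperimetricForm hm hz hnormal harea
  have hmean : ∫ s in (0 : ℝ)..L, z s = 0 := by
    simpa [curveCentroid, hLc] using hcentroid
  have ha0 : fourierCoeffOn hL z 0 = 0 := by
    rw [fourierCoeffOn_eq_integral]
    simp [hmean]
  have hw : 0 < (L / (2 * Real.pi)) ^ (-(1 : ℤ)) * L := by positivity
  have hnonneg : ∀ k : ℤ, 0 ≤ (L / (2 * Real.pi)) ^ (-(1 : ℤ)) * L * (((k : ℝ) ^ 2 - 1) *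
      realP m ((k : ℝ) ^ 2) * ‖fourierCoeffOn hL z k‖ ^ 2) := by
    intro k
    rcases eq_or_ne k 0 with rfl | hk
    · simp [ha0]
    rcases le_or_gt |k| (m : ℤ) with h | h
    · simp [weight_eq_zero hk h]
    · exact mul_nonneg hw.le (mul_nonneg (weight_pos hm h).le (sq_nonneg _))
  refine ⟨hsum.nonneg hnonneg, fun h0 => ?_, ?_⟩
  · rw [h0, hasSum_zero_iff_of_nonneg hnonneg] at hsum
    have hak : ∀ k : ℤ, (m : ℤ) < |k| → fourierCoeffOn hL (deriv z) k = 0 := by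
      intro k hk
      have h := congrFun hsum k
      simp only [Pi.zero_apply] at h
      have h' := (mul_eq_zero.1 ((mul_eq_zero.1 h).resolve_left hw.ne')).resolve_left
        (weight_pos hm hk).ne'
      rw [fourierCoeffOn_deriv hL hz1 hz.periodic,
        norm_eq_zero.1 ((pow_eq_zero_iff two_ne_zero).1 h'), mul_zero]
    obtain ⟨c, p, hc⟩ := exists_deriv_eq_exp hL (hz1.continuous_deriv le_rfl) hz.periodic.deriv'
      hz.unit_speed hak
    obtain ⟨b, hp, hb⟩ := hz.exists_eq_exp hm hmean hc
    have hp1 : p = 1 := by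
      refine (eq_or_eq_neg_of_abs_eq hp).resolve_right fun hneg => ?_
      -- A circle run through clockwise would enclose negative area.
      have hd : ∀ s, (starRingEnd ℂ) (z s) * deriv z s =
          -(2 * Real.pi * I / L) * ((‖z s‖ ^ 2 : ℝ) : ℂ) := by
        intro s
        have h1 := ((hasDerivAt_exp_mul_div L p s).const_mul b).deriv
        rw [← funext hb] at h1
        rw [h1, ← Complex.normSq_eq_norm_sq, Complex.normSq_eq_conj_mul_self, hb s, hneg]
        push_cast
        ring
      simp only [hd] at harea
      rw [intervalIntegral.integral_const_mul, intervalIntegral.integral_ofReal] at harea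
      have him := congrArg Complex.im harea
      have e1 : (2 * I * (volume.real Ω : ℂ)).im = 2 * volume.real Ω := by simp
      have e2 : (-(2 * Real.pi * I / L) * ((∫ s in (0 : ℝ)..L, ‖z s‖ ^ 2 : ℝ) : ℂ)).im =
          -(2 * Real.pi / L * ∫ s in (0 : ℝ)..L, ‖z s‖ ^ 2) := by
        have : (-(2 * Real.pi * I / L) * ((∫ s in (0 : ℝ)..L, ‖z s‖ ^ 2 : ℝ) : ℂ)) =
            ((-(2 * Real.pi / L * ∫ s in (0 : ℝ)..L, ‖z s‖ ^ 2) : ℝ) : ℂ) * I := by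
          push_cast
          ring
        rw [this]
        simp
      rw [e1, e2] at him
      have hvol : 0 ≤ volume.real Ω := measureReal_nonneg
      have hb0 : b ≠ 0 := by
        rintro rfl
        have hz0 : z = fun _ => 0 := funext fun s => by rw [hb s, zero_mul]
        have := hz.unit_speed 0
        rw [hz0] at this
        simp at this
      have hzpos : ∀ s, 0 < ‖z s‖ ^ 2 := fun s => by
        rw [hb s]
        exact pow_pos (norm_pos_iff.2 (mul_ne_zero hb0 (Complex.exp_ne_zero _))) 2
      have hpos : 0 < ∫ s in (0 : ℝ)..L, ‖z s‖ ^ 2 :=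
        intervalIntegral.intervalIntegral_pos_of_pos
          ((hz1.continuous.norm.pow 2).intervalIntegrable _ _) hzpos hL
      have : 0 < 2 * Real.pi / L * ∫ s in (0 : ℝ)..L, ‖z s‖ ^ 2 := by positivity
      linarith
    refine ⟨b, fun s => ?_⟩
    rw [hb s, hp1]
    congr 2
    push_cast
    ring
  · rintro ⟨b, hb⟩
    have hzero : ∀ k : ℤ, k ≠ 1 → fourierCoeffOn hL z k = 0 := by
      intro k hk
      have hb' : ∀ s : ℝ, z s = b * Complex.exp (2 * Real.pi * I * (1 : ℤ) * s / L) := by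
        intro s
        rw [hb s]
        congr 2
        push_cast
        ring
      have hd : deriv z = fun s => (2 * Real.pi * I / L) * z s := by
        funext s
        have h1 := ((hasDerivAt_exp_mul_div L 1 s).const_mul b).deriv
        rw [← funext hb'] at h1
        rw [h1, hb' s]
        push_cast
        ring
      have h1 := fourierCoeffOn_deriv hL hz1 hz.periodic k
      rw [hd, fourierCoeffOn.const_mul] at h1
      have h2 : (2 * Real.pi * I / L * (k - 1) : ℂ) * fourierCoeffOn hL z k = 0 := by
        linear_combination -h1
      have hpc : (Real.pi : ℂ) ≠ 0 := by exact_mod_cast Real.pi_ne_zero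
      have hk1 : (k : ℂ) - 1 ≠ 0 := by
        rw [sub_ne_zero]
        exact_mod_cast hk
      refine (mul_eq_zero.1 h2).resolve_left (mul_ne_zero (div_ne_zero ?_ hLc) hk1)
      simp [hpc]
    have hterm : ∀ k : ℤ, (L / (2 * Real.pi)) ^ (-(1 : ℤ)) * L * (((k : ℝ) ^ 2 - 1) *
        realP m ((k : ℝ) ^ 2) * ‖fourierCoeffOn hL z k‖ ^ 2) = 0 := by
      intro k
      rcases eq_or_ne k 1 with rfl | hk
      · simp
      · simp [hzero k hk]
    exact hsum.unique (hasSum_zero.of_eq hterm rfl)
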